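/- Let $n\ge 2$ and let $(\widetilde M,\widetilde g,J)$ be a Kähler manifold of complex dimension $n$ with constant holomorphic sectional curvature $c\neq 0$ (in particular $\mathbb{C}P^n$ or $\mathbb{C}H^n$). Let $M$ be a nonempty immersed real hypersurface of $\widetilde M$ (real dimension $2n-1$) with induced metric $g$ and curvature tensor $R$. For a local unit normal field $N$ let $\xi=-JN$, $\eta=g(\cdot,\xi)$, let $A$ be the shape operator and let $\phi X$ be the tangential part of $JX$. Write $A\xi=a\xi+V$ with $a=\eta(A\xi)$ and $\eta(V)=0$; the vector field $V$ does not depend on the choice of $N$, so it is defined on all of $M$. Let $$\mathrm{Ric}^*(X,Y)=\tfrac12\operatorname{trace}\{\phi\circ R(X,\phi Y)\}.$$ Suppose that $g$ is a $^*$-Ricci soliton with potential vector field $V$, that is, there is a constant $\lambda\in\mathbb{R}$ with $$\tfrac12\mathcal{L}_Vg+\mathrm{Ric}^*-\lambda g=0\quad\text{on } M.$$ Then $M$ is a Hopf hypersurface ($\xi$ is an eigenvector of $A$ at every point) and is $^*$-Ricci flat ($\mathrm{Ric}^*=0$ on $M$); moreover $V=0$ and $\lambda=0$. -/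

import Mathlib

set_option maxSynthPendingDepth 3

open scoped Manifold ContDiff
open Module

namespace StarRicci

/-- A complex manifold is a smooth real manifold with the same charts. -/
instance realManifold {F : Type*} [NormedAddCommGroup F] [NormedSpace ℂ F]
    {N : Type*} [TopologicalSpace N] [ChartedSpace F N] [IsManifold 𝓘(ℂ, F) ω N] :
    IsManifold 𝓘(ℝ, F) ω N := by
  refine isManifold_of_contDiffOn 𝓘(ℝ, F) ω N fun e e' he he' => ?_
  have h := (contDiffGroupoid ω 𝓘(ℂ, F)).compatible he he'
  have h1 : ContDiffOn ℂ ω (e.symm ≫ₕ e') (e.symm ≫ₕ e').source := by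
    simpa [contDiffPregroupoid] using (mem_groupoid_of_pregroupoid.1 h).1
  simpa using h1.restrict_scalars ℝ

section Coordinates

/-! Riemannian geometry on an open piece of a real vector space `E`. A metric in coordinates is a
function `g` from points of `E` to bilinear forms; tangent vectors are elements of `E`. -/

variable {E : Type*} [NormedAddCommGroup E] [NormedSpace ℝ E]

/-- The form `(u, v, w) ↦ ½ (∂_u g(v, w) + ∂_v g(u, w) - ∂_w g(u, v))`. -/
noncomputable def koszul (g : E → E →L[ℝ] E →L[ℝ] ℝ) (y : E) : E →L[ℝ] E →L[ℝ] E →L[ℝ] ℝ :=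
  let D : E →L[ℝ] E →L[ℝ] E →L[ℝ] ℝ := fderiv ℝ g y
  let T : (E →L[ℝ] E →L[ℝ] ℝ) →L[ℝ] E →L[ℝ] E →L[ℝ] ℝ :=
    (ContinuousLinearMap.flipₗᵢ ℝ E E ℝ).toContinuousLinearEquiv.toContinuousLinearMap
  (1 / 2 : ℝ) • (D + D.flip - T ∘L D.flip)

/-- The Christoffel symbols `Γ(u, v)` of the Levi-Civita connection of `g`, that is,
`g(Γ(u, v), w) = ½ (∂_u g(v, w) + ∂_v g(u, w) - ∂_w g(u, v))`. For vector fields in coordinates,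
`∇_X Y = ∂_X Y + Γ(X, Y)`. -/
noncomputable def christoffel (g : E → E →L[ℝ] E →L[ℝ] ℝ) (y : E) : E →L[ℝ] E →L[ℝ] E :=
  ContinuousLinearMap.compL ℝ E (E →L[ℝ] ℝ) E (g y).inverse ∘L koszul g y

/-- The curvature tensor `R(u, v)w = ∇_u ∇_v w - ∇_v ∇_u w` (with `u`, `v`, `w` extended as constant
coordinate fields, so that `[u, v] = 0`), as an endomorphism in `w`. -/
noncomputable def curvature (g : E → E →L[ℝ] E →L[ℝ] ℝ) (y u v : E) : E →L[ℝ] E :=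
  fderiv ℝ (christoffel g) y u v - fderiv ℝ (christoffel g) y v u
    + christoffel g y u ∘L christoffel g y v - christoffel g y v ∘L christoffel g y u

/-- The Lie derivative `(𝓛_W g)(u, v) = (∂_W g)(u, v) + g(∂_u W, v) + g(u, ∂_v W)`. -/
noncomputable def lieMetric (W : E → E) (g : E → E →L[ℝ] E →L[ℝ] ℝ) (y u v : E) : ℝ :=
  fderiv ℝ g y (W y) u v + g y (fderiv ℝ W y u) v + g y u (fderiv ℝ W y v)

/-! A parametrized piece `Φ : E → F` of a hypersurface in a complex vector space `F` that carries a
Riemannian metric `h` in coordinates. The complex structure is multiplication by `i`. -/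

variable {F : Type*} [NormedAddCommGroup F] [NormedSpace ℂ F]

/-- The complex structure `J`. -/
noncomputable def cplxJ (F : Type*) [NormedAddCommGroup F] [NormedSpace ℂ F] : F →L[ℝ] F :=
  (Complex.I • ContinuousLinearMap.id ℂ F).restrictScalars ℝ

variable (h : F → F →L[ℝ] F →L[ℝ] ℝ) (Φ : E → F)

/-- The induced metric `g(u, v) = h(dΦ u, dΦ v)`. -/
noncomputable def inducedMetric (y : E) : E →L[ℝ] E →L[ℝ] ℝ :=
  (h (Φ y)).bilinearComp (fderiv ℝ Φ y) (fderiv ℝ Φ y)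

/-- The tangential part of an ambient vector `z` at `Φ y`, as a coordinate vector:
the vector `u` with `g(u, v) = h(z, dΦ v)` for all `v`. -/
noncomputable def tangPart (y : E) : F →L[ℝ] E :=
  (inducedMetric h Φ y).inverse ∘L
    (h (Φ y)).bilinearComp (ContinuousLinearMap.id ℝ F) (fderiv ℝ Φ y)

/-- `ν` is a unit normal vector at `Φ y`. -/
def IsUnitNormal (y : E) (ν : F) : Prop :=
  (∀ u : E, h (Φ y) ν (fderiv ℝ Φ y u) = 0) ∧ h (Φ y) ν ν = 1

/-- The structure tensor `φ`: the tangential part of `J`. -/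
noncomputable def phi (y : E) : E →L[ℝ] E :=
  tangPart h Φ y ∘L cplxJ F ∘L fderiv ℝ Φ y

/-- The structure vector `ξ = -Jν`. -/
noncomputable def xi (y : E) (ν : F) : E := tangPart h Φ y (-(cplxJ F ν))

/-- The ambient derivative of one tangent coordinate field along another,
`∇̃_u (dΦ v) = D²Φ(u, v) + Γ̃(dΦ u, dΦ v)`. -/
noncomputable def ambientDeriv (y : E) : E →L[ℝ] E →L[ℝ] F :=
  fderiv ℝ (fderiv ℝ Φ) y + (christoffel h (Φ y)).bilinearComp (fderiv ℝ Φ y) (fderiv ℝ Φ y)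

/-- The shape operator `A` with respect to the unit normal `ν`, given by the Gauss formula:
`g(A u, v)` is the `ν`-component `h(ν, ∇̃_u (dΦ v))`. -/
noncomputable def shape (y : E) (ν : F) : E →L[ℝ] E :=
  (inducedMetric h Φ y).inverse ∘L
    ContinuousLinearMap.compL ℝ E F ℝ (h (Φ y) ν) ∘L ambientDeriv h Φ y

/-- The component of `Aξ` orthogonal to `ξ`, that is `V = Aξ - η(Aξ)ξ` where `η = g(·, ξ)`. It does
not change when `ν` is replaced by `-ν`. -/
noncomputable def holPart (y : E) (ν : F) : E :=
  shape h Φ y ν (xi h Φ y ν) -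
    inducedMetric h Φ y (shape h Φ y ν (xi h Φ y ν)) (xi h Φ y ν) • xi h Φ y ν

/-- The *-Ricci tensor `Ric*(u, v) = ½ trace (φ ∘ R(u, φ v))`, where `R` is the curvature tensor of
the induced metric. -/
noncomputable def starRic (y u v : E) : ℝ :=
  (1 / 2) * LinearMap.trace ℝ E
    (phi h Φ y ∘L curvature (inducedMetric h Φ) y u (phi h Φ y v) : E →L[ℝ] E)

end Coordinates

section Ambient

variable {F : Type*} [NormedAddCommGroup F] [NormedSpace ℂ F]
  {N : Type*} [TopologicalSpace N] [ChartedSpace F N] [IsManifold 𝓘(ℂ, F) ω N]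

/-- A smooth Riemannian metric on (the real manifold underlying) a complex manifold. -/
abbrev Metric (F : Type*) [NormedAddCommGroup F] [NormedSpace ℂ F]
    (N : Type*) [TopologicalSpace N] [ChartedSpace F N] [IsManifold 𝓘(ℂ, F) ω N] :=
  Bundle.ContMDiffRiemannianMetric 𝓘(ℝ, F) ∞ F (fun q : N => TangentSpace 𝓘(ℝ, F) q)

/-- The inner product on the tangent space at `q`. -/
noncomputable def metricAt (g : Metric F N) (q : N) : F →L[ℝ] F →L[ℝ] ℝ := g.inner q

/-- The derivative of the inverse of the chart `e`, from the coordinate space to the tangent space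
of `N` at the point with coordinates `z`. -/
noncomputable def coordFrame (e : OpenPartialHomeomorph N F) (z : F) : F →L[ℝ] F :=
  mfderiv 𝓘(ℝ, F) 𝓘(ℝ, F) e.symm z

/-- The metric `g` in the chart `e`. -/
noncomputable def chartMetric (g : Metric F N) (e : OpenPartialHomeomorph N F) (z : F) :
    F →L[ℝ] F →L[ℝ] ℝ :=
  (metricAt g (e.symm z)).bilinearComp (coordFrame e z) (coordFrame e z)

/-- `g` is a Kähler metric: it is Hermitian, and the complex structure is parallel for the
Levi-Civita connection (in a holomorphic chart `J` is constant, so `∇J = 0` reads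
`Γ(u, Jv) = J Γ(u, v)`). -/
def IsKaehler (g : Metric F N) : Prop :=
  ∀ e ∈ atlas F N, ∀ z ∈ e.target, ∀ u v : F,
    chartMetric g e z (cplxJ F u) (cplxJ F v) = chartMetric g e z u v ∧
    christoffel (chartMetric g e) z u (cplxJ F v) = cplxJ F (christoffel (chartMetric g e) z u v)

/-- All holomorphic sectional curvatures are equal to `c`. -/
def HasConstHolCurvature (g : Metric F N) (c : ℝ) : Prop :=
  ∀ e ∈ atlas F N, ∀ z ∈ e.target, ∀ u : F,
    chartMetric g e z (curvature (chartMetric g e) z u (cplxJ F u) (cplxJ F u)) u =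
      c * chartMetric g e z u u ^ 2

/-- A complex space form of holomorphic sectional curvature `c`. -/
def IsComplexSpaceForm (g : Metric F N) (c : ℝ) : Prop :=
  IsKaehler g ∧ HasConstHolCurvature g c

end Ambient

section Hypersurface

variable {F : Type*} [NormedAddCommGroup F] [NormedSpace ℂ F]
  {N : Type*} [TopologicalSpace N] [ChartedSpace F N] [IsManifold 𝓘(ℂ, F) ω N]
  {E : Type*} [NormedAddCommGroup E] [NormedSpace ℝ E]
  {M : Type*} [TopologicalSpace M] [ChartedSpace E M] [IsManifold 𝓘(ℝ, E) ∞ M]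

/-- A smooth immersion. -/
def IsSmoothImmersion (E F : Type*) [NormedAddCommGroup E] [NormedSpace ℝ E]
    [NormedAddCommGroup F] [NormedSpace ℂ F] {M N : Type*} [TopologicalSpace M] [ChartedSpace E M]
    [TopologicalSpace N] [ChartedSpace F N] (f : M → N) : Prop :=
  ContMDiff 𝓘(ℝ, E) 𝓘(ℝ, F) ∞ f ∧
    ∀ p : M, Function.Injective (mfderiv 𝓘(ℝ, E) 𝓘(ℝ, F) f p)

/-- The coordinate expression of `f : M → N` in the charts `e` and `e'`. -/
def chartMap (f : M → N) (e : OpenPartialHomeomorph M E) (e' : OpenPartialHomeomorph N F) : E → F :=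
  e' ∘ f ∘ e.symm

/-- The set of coordinates on which the expression of `f` in the charts `e` and `e'` makes sense. -/
def chartDomain (f : M → N) (e : OpenPartialHomeomorph M E) (e' : OpenPartialHomeomorph N F) :
    Set E :=
  {y | y ∈ e.target ∧ f (e.symm y) ∈ e'.source}

/-- The coordinate expression of a vector field `W` on `M` in the chart `e`. -/
noncomputable def chartField (W : ∀ p : M, TangentSpace 𝓘(ℝ, E) p)
    (e : OpenPartialHomeomorph M E) (y : E) : E :=
  mfderiv 𝓘(ℝ, E) 𝓘(ℝ, E) e (e.symm y) (W (e.symm y))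

/-! Tensorial conditions on the hypersurface `f : M → N` are imposed in all pairs of charts of the
two atlases, at every point where they apply. -/

/-- The vector field `W` is the component of `Aξ` in the holomorphic distribution
`𝓓 = {X : η(X) = 0}`. -/
def IsHolPart (g : Metric F N) (f : M → N) (W : ∀ p : M, TangentSpace 𝓘(ℝ, E) p) : Prop :=
  ∀ e ∈ atlas E M, ∀ e' ∈ atlas F N, ∀ y ∈ chartDomain f e e', ∀ ν : F,
    IsUnitNormal (chartMetric g e') (chartMap f e e') y ν →
      chartField W e y = holPart (chartMetric g e') (chartMap f e e') y ν

/-- The induced metric is a *-Ricci soliton with potential vector field `W` and constant `lam`: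
`½ 𝓛_W g + Ric* - lam g = 0`. -/
def IsStarRicciSoliton (g : Metric F N) (f : M → N) (W : ∀ p : M, TangentSpace 𝓘(ℝ, E) p)
    (lam : ℝ) : Prop :=
  ContMDiff 𝓘(ℝ, E) 𝓘(ℝ, E).tangent ∞ (fun p => (⟨p, W p⟩ : TangentBundle 𝓘(ℝ, E) M)) ∧
  ∀ e ∈ atlas E M, ∀ e' ∈ atlas F N, ∀ y ∈ chartDomain f e e', ∀ u v : E,
    (1 / 2) * lieMetric (chartField W e) (inducedMetric (chartMetric g e') (chartMap f e e')) y u v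
      + starRic (chartMetric g e') (chartMap f e e') y u v
      - lam * inducedMetric (chartMetric g e') (chartMap f e e') y u v = 0

/-- The hypersurface is Hopf: at every point `ξ` is an eigenvector of the shape operator. -/
def IsHopf (E : Type*) [NormedAddCommGroup E] [NormedSpace ℝ E] {M : Type*} [TopologicalSpace M]
    [ChartedSpace E M] (g : Metric F N) (f : M → N) : Prop :=
  ∀ e ∈ atlas E M, ∀ e' ∈ atlas F N, ∀ y ∈ chartDomain f e e', ∀ ν : F,
    IsUnitNormal (chartMetric g e') (chartMap f e e') y ν →
      ∃ a : ℝ, shape (chartMetric g e') (chartMap f e e') y ν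
          (xi (chartMetric g e') (chartMap f e e') y ν) =
        a • xi (chartMetric g e') (chartMap f e e') y ν

/-- The hypersurface is *-Ricci flat: `Ric* = 0`. -/
def IsStarRicciFlat (E : Type*) [NormedAddCommGroup E] [NormedSpace ℝ E] {M : Type*}
    [TopologicalSpace M] [ChartedSpace E M] (g : Metric F N) (f : M → N) : Prop :=
  ∀ e ∈ atlas E M, ∀ e' ∈ atlas F N, ∀ y ∈ chartDomain f e e', ∀ u v : E,
    starRic (chartMetric g e') (chartMap f e e') y u v = 0

end Hypersurface

end StarRicci

set_option linter.unusedSectionVars false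

/-! Write `p = φV` and `η = g(·, ξ)`, so that `Aξ = V + aξ` with `V ⟂ ξ`. The soliton equation is
tested on three pairs of vectors.

On `(ξ, ξ)`: since `J` is parallel, `∇_u ξ = φAu`, so `∇_ξ ξ = φAξ = φV ⟂ V`. Differentiating `g(V,
ξ) = 0` along `ξ` gives `g(∇_ξ V, ξ) = 0`. As `Ric*(·, ξ) = 0` because `φξ = 0`, the constant is `0`
(`soliton_const_eq_zero`).

On `(ξ, v)`: the soliton equation makes `Ric*` symmetric, so `Ric*(ξ, ·) = 0` too. The Gauss
equation in a complex space form gives `Ric*(u, v) = (cn/2) g(φu, φv) + g(φAu, Aφv)` (`starRic_eq`),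
whence `g(Ap, φv) = 0` for all `v`. Also `g(Ap, ξ) = g(p, V + aξ) = 0`, so `Ap = 0`
(`shape_phi_holPart_eq_zero`).

On `(p, p)`: the Codazzi equation for `p, ξ`, paired with `p`, together with `Ap = 0` yields `g(∇_p
V, p) = 0` (`metric_covAlong_holPart_phi`). Only `Ric*(p, p) = (cn/2) |φp|² = (cn/2) |V|²` remains,
and it must vanish. As `c ≠ 0`, `V = 0`; then `Aξ = aξ`, and the soliton equation reduces to `Ric* =
0`.

Everything is local and done in charts. The form of the ambient curvature comes from the algebraic
fact that a Kähler curvature tensor is determined by its holomorphic sectional curvature. -/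

namespace StarRicci

/-! ### Levi-Civita connection of a metric in coordinates -/

section MetricCalculus

variable {E : Type*} [NormedAddCommGroup E] [NormedSpace ℝ E]

/-- `g` is a smooth Riemannian metric on the open set `s`. -/
structure IsMetricOn (g : E → E →L[ℝ] E →L[ℝ] ℝ) (s : Set E) : Prop where
  isOpen : IsOpen s
  smooth : ContDiffOn ℝ ∞ g s
  symm : ∀ y ∈ s, ∀ u v, g y u v = g y v u
  pos : ∀ y ∈ s, ∀ u, u ≠ 0 → 0 < g y u u

/-- The product rule for a field of bilinear forms applied to two vector fields. -/
theorem fderiv_bilin {E G G' H : Type*} [NormedAddCommGroup E] [NormedSpace ℝ E]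
    [NormedAddCommGroup G] [NormedSpace ℝ G] [NormedAddCommGroup G'] [NormedSpace ℝ G']
    [NormedAddCommGroup H] [NormedSpace ℝ H]
    {b : E → G →L[ℝ] G' →L[ℝ] H} {X : E → G} {Y : E → G'} {y : E}
    (hb : DifferentiableAt ℝ b y) (hX : DifferentiableAt ℝ X y) (hY : DifferentiableAt ℝ Y y)
    (u : E) :
    fderiv ℝ (fun z => b z (X z) (Y z)) y u =
      fderiv ℝ b y u (X y) (Y y) + b y (fderiv ℝ X y u) (Y y) + b y (X y) (fderiv ℝ Y y u) := by
  have := ((hb.hasFDerivAt.clm_apply hX.hasFDerivAt).clm_apply hY.hasFDerivAt).fderiv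
  rw [this]
  simp
  abel

/-- The derivative of a field of linear maps applied to a vector field. -/
theorem fderiv_lin {E G H : Type*} [NormedAddCommGroup E] [NormedSpace ℝ E]
    [NormedAddCommGroup G] [NormedSpace ℝ G]
    [NormedAddCommGroup H] [NormedSpace ℝ H]
    {b : E → G →L[ℝ] H} {X : E → G} {y : E}
    (hb : DifferentiableAt ℝ b y) (hX : DifferentiableAt ℝ X y) (u : E) :
    fderiv ℝ (fun z => b z (X z)) y u = fderiv ℝ b y u (X y) + b y (fderiv ℝ X y u) := by
  rw [(hb.hasFDerivAt.clm_apply hX.hasFDerivAt).fderiv]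
  simp
  abel

variable {g : E → E →L[ℝ] E →L[ℝ] ℝ} {s : Set E}

theorem IsMetricOn.contDiffAt (hg : IsMetricOn g s) {y : E} (hy : y ∈ s) : ContDiffAt ℝ ∞ g y :=
  hg.smooth.contDiffAt (hg.isOpen.mem_nhds hy)

theorem IsMetricOn.differentiableAt (hg : IsMetricOn g s) {y : E} (hy : y ∈ s) :
    DifferentiableAt ℝ g y :=
  (hg.contDiffAt hy).differentiableAt (by simp)

theorem IsMetricOn.ext (hg : IsMetricOn g s) {y : E} (hy : y ∈ s) {u v : E}
    (h : ∀ w, g y u w = g y v w) : u = v := by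
  by_contra hne
  have := hg.pos y hy (u - v) (sub_ne_zero.2 hne)
  simp [h] at this

theorem IsMetricOn.fderiv_symm (hg : IsMetricOn g s) {y : E} (hy : y ∈ s) (u v w : E) :
    fderiv ℝ g y u v w = fderiv ℝ g y u w v := by
  have hd := hg.differentiableAt hy
  have h1 := fderiv_bilin hd (differentiableAt_const v) (differentiableAt_const w) u
  have h2 := fderiv_bilin hd (differentiableAt_const w) (differentiableAt_const v) u
  have h3 : (fun z => g z v w) =ᶠ[nhds y] fun z => g z w v := by
    filter_upwards [hg.isOpen.mem_nhds hy] with z hz using hg.symm z hz v w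
  rw [h3.fderiv_eq, h2] at h1
  simpa using h1.symm

theorem koszul_apply (g : E → E →L[ℝ] E →L[ℝ] ℝ) (y u v w : E) :
    koszul g y u v w =
      (1 / 2) * (fderiv ℝ g y u v w + fderiv ℝ g y v u w - fderiv ℝ g y w u v) := by
  simp [koszul]

theorem koszul_contDiffAt {y : E} (hg : ContDiffAt ℝ ∞ g y) : ContDiffAt ℝ ∞ (koszul g) y := by
  have hD : ContDiffAt ℝ ∞ (fderiv ℝ g) y := hg.fderiv_right (by simp)
  have hF : ContDiffAt ℝ ∞ (fun z => (fderiv ℝ g z).flip) y :=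
    (ContinuousLinearMap.flipₗᵢ ℝ E E (E →L[ℝ] ℝ)).toContinuousLinearEquiv.contDiff.contDiffAt.comp
      y hD
  unfold koszul
  exact ContDiffAt.const_smul _ ((hD.add hF).sub (contDiffAt_const.clm_comp hF))

variable [FiniteDimensional ℝ E]

/-- `ContinuousLinearMap.inverse` is zero on maps that are not invertible, so the formulas for
`christoffel`, `tangPart` and `shape` mean something only through this fact: definiteness gives
injectivity, and `E` and its dual have equal dimension. -/
theorem IsMetricOn.isInvertible (hg : IsMetricOn g s) {y : E} (hy : y ∈ s) :
    (g y).IsInvertible := by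
  have hinj : Function.Injective (g y : E →ₗ[ℝ] E →L[ℝ] ℝ) := fun u v h =>
    hg.ext hy fun w => congrArg (fun l : E →L[ℝ] ℝ => l w) h
  have hfin : finrank ℝ E = finrank ℝ (E →L[ℝ] ℝ) := by
    rw [← LinearMap.toContinuousLinearMap.finrank_eq]
    exact (Subspace.dual_finrank_eq (K := ℝ) (V := E)).symm
  exact ⟨(LinearEquiv.ofInjectiveOfFinrankEq _ hinj hfin).toContinuousLinearEquiv, by ext; rfl⟩

theorem IsMetricOn.apply_inverse (hg : IsMetricOn g s) {y : E} (hy : y ∈ s) (l : E →L[ℝ] ℝ) :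
    g y ((g y).inverse l) = l :=
  (hg.isInvertible hy).self_apply_inverse l

theorem IsMetricOn.contDiffAt_inverse (hg : IsMetricOn g s) {y : E} (hy : y ∈ s) :
    ContDiffAt ℝ ∞ (fun z => (g z).inverse) y :=
  ContDiffAt.comp y (hg.isInvertible hy).contDiffAt_map_inverse (hg.contDiffAt hy)

theorem IsMetricOn.christoffel_apply (hg : IsMetricOn g s) {y : E} (hy : y ∈ s) (u v w : E) :
    g y (christoffel g y u v) w =
      (1 / 2) * (fderiv ℝ g y u v w + fderiv ℝ g y v u w - fderiv ℝ g y w u v) := by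
  rw [← koszul_apply, christoffel]
  simp [hg.apply_inverse hy]

theorem IsMetricOn.christoffel_comm (hg : IsMetricOn g s) {y : E} (hy : y ∈ s) (u v : E) :
    christoffel g y u v = christoffel g y v u := by
  refine hg.ext hy fun w => ?_
  rw [hg.christoffel_apply hy, hg.christoffel_apply hy, hg.fderiv_symm hy w u v]
  ring

/-- Metric compatibility, `∇g = 0`: in the sum of the two Koszul formulas the other derivatives of
`g` cancel. -/
theorem IsMetricOn.fderiv_eq (hg : IsMetricOn g s) {y : E} (hy : y ∈ s) (u v w : E) :
    fderiv ℝ g y u v w = g y (christoffel g y u v) w + g y v (christoffel g y u w) := by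
  rw [hg.symm y hy v, hg.christoffel_apply hy, hg.christoffel_apply hy, hg.fderiv_symm hy w u v,
    hg.fderiv_symm hy v u w, hg.fderiv_symm hy u v w]
  ring

theorem IsMetricOn.christoffel_contDiffAt (hg : IsMetricOn g s) {y : E} (hy : y ∈ s) :
    ContDiffAt ℝ ∞ (christoffel g) y := by
  unfold christoffel
  exact ((ContinuousLinearMap.compL ℝ E (E →L[ℝ] ℝ) E).contDiff.contDiffAt.comp y
    (hg.contDiffAt_inverse hy)).clm_comp (koszul_contDiffAt (hg.contDiffAt hy))

theorem IsMetricOn.christoffel_differentiableAt (hg : IsMetricOn g s) {y : E} (hy : y ∈ s) :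
    DifferentiableAt ℝ (christoffel g) y :=
  (hg.christoffel_contDiffAt hy).differentiableAt (by simp)

end MetricCalculus

/-! ### Covariant derivatives of vector fields along a map -/

section Along

variable {E : Type*} [NormedAddCommGroup E] [NormedSpace ℝ E]
  {F : Type*} [NormedAddCommGroup F] [NormedSpace ℝ F]

/-- `Φ` is a smooth immersion of the open set `s` into `t`. -/
structure IsImmersionOn (Φ : E → F) (s : Set E) (t : Set F) : Prop where
  isOpen : IsOpen s
  smooth : ContDiffOn ℝ ∞ Φ s
  mapsTo : Set.MapsTo Φ s t
  inj : ∀ y ∈ s, Function.Injective (fderiv ℝ Φ y)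

/-- Along the identity, `covAlong` is the Levi-Civita connection itself, so the same lemmas serve
the ambient connection, the induced one and the pullback along the hypersurface. -/
theorem isImmersionOn_id {s : Set E} (hs : IsOpen s) : IsImmersionOn (fun y : E => y) s s :=
  ⟨hs, contDiffOn_id, fun _ h => h, fun _ _ => by simp [Function.injective_id]⟩

/-- The covariant derivative, with respect to the metric `h`, of the vector field `Z` along `Φ` in
the direction `u`. -/
noncomputable def covAlong (h : F → F →L[ℝ] F →L[ℝ] ℝ) (Φ : E → F) (Z : E → F) (y u : E) : F :=
  fderiv ℝ Z y u + christoffel h (Φ y) (fderiv ℝ Φ y u) (Z y)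

variable {h : F → F →L[ℝ] F →L[ℝ] ℝ} {Φ : E → F} {s : Set E} {t : Set F}

theorem IsImmersionOn.contDiffAt (hΦ : IsImmersionOn Φ s t) {y : E} (hy : y ∈ s) :
    ContDiffAt ℝ ∞ Φ y :=
  hΦ.smooth.contDiffAt (hΦ.isOpen.mem_nhds hy)

theorem IsImmersionOn.differentiableAt (hΦ : IsImmersionOn Φ s t) {y : E} (hy : y ∈ s) :
    DifferentiableAt ℝ Φ y :=
  (hΦ.contDiffAt hy).differentiableAt (by simp)

theorem IsImmersionOn.fderiv_contDiffAt (hΦ : IsImmersionOn Φ s t) {y : E} (hy : y ∈ s) :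
    ContDiffAt ℝ ∞ (fderiv ℝ Φ) y :=
  (hΦ.contDiffAt hy).fderiv_right (by simp)

theorem IsImmersionOn.fderiv_differentiableAt (hΦ : IsImmersionOn Φ s t) {y : E} (hy : y ∈ s) :
    DifferentiableAt ℝ (fderiv ℝ Φ) y :=
  (hΦ.fderiv_contDiffAt hy).differentiableAt (by simp)

theorem snd_fderiv_comm {Z : E → F} {y : E} (hZ : ContDiffAt ℝ ∞ Z y) (u v : E) :
    fderiv ℝ (fderiv ℝ Z) y u v = fderiv ℝ (fderiv ℝ Z) y v u :=
  (hZ.isSymmSndFDerivAt (by simpa using ENat.LEInfty.out)).eq u v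

theorem fderiv_fderiv_apply {Z : E → F} {y : E} (hZ : ContDiffAt ℝ ∞ Z y) (u v : E) :
    fderiv ℝ (fun z => fderiv ℝ Z z v) y u = fderiv ℝ (fderiv ℝ Z) y u v := by
  have hd : DifferentiableAt ℝ (fderiv ℝ Z) y :=
    (hZ.fderiv_right (m := ∞) (by simp)).differentiableAt (by simp)
  simpa using fderiv_lin hd (differentiableAt_const v) u

theorem metric_along_differentiableAt (hh : IsMetricOn h t) (hΦ : IsImmersionOn Φ s t) {y : E}
    (hy : y ∈ s) : DifferentiableAt ℝ (fun z => h (Φ z)) y :=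
  (hh.differentiableAt (hΦ.mapsTo hy)).comp y (hΦ.differentiableAt hy)

/-- The connection is metric. -/
theorem fderiv_metric_along [FiniteDimensional ℝ F]
    (hh : IsMetricOn h t) (hΦ : IsImmersionOn Φ s t) {y : E}
    (hy : y ∈ s) {X Y : E → F} (hX : DifferentiableAt ℝ X y) (hY : DifferentiableAt ℝ Y y) (u : E) :
    fderiv ℝ (fun z => h (Φ z) (X z) (Y z)) y u =
      h (Φ y) (covAlong h Φ X y u) (Y y) + h (Φ y) (X y) (covAlong h Φ Y y u) := by
  have hc : fderiv ℝ (fun z => h (Φ z)) y = fderiv ℝ h (Φ y) ∘L fderiv ℝ Φ y :=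
    fderiv_comp y (hh.differentiableAt (hΦ.mapsTo hy)) (hΦ.differentiableAt hy)
  rw [fderiv_bilin (b := fun z => h (Φ z)) (metric_along_differentiableAt hh hΦ hy) hX hY, hc]
  simp only [ContinuousLinearMap.comp_apply, hh.fderiv_eq (hΦ.mapsTo hy), covAlong, map_add,
    add_apply]
  ring

/-- The curvature measures the failure of covariant derivatives along `Φ` to commute. -/
theorem covAlong_covAlong_sub [FiniteDimensional ℝ F]
    (hh : IsMetricOn h t) (hΦ : IsImmersionOn Φ s t) {y : E}
    (hy : y ∈ s) {Z : E → F} (hZ : ContDiffAt ℝ ∞ Z y) (u v : E) :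
    covAlong h Φ (fun z => covAlong h Φ Z z v) y u - covAlong h Φ (fun z => covAlong h Φ Z z u) y v
      = curvature h (Φ y) (fderiv ℝ Φ y u) (fderiv ℝ Φ y v) (Z y) := by
  have hc : fderiv ℝ (fun z => christoffel h (Φ z)) y =
      fderiv ℝ (christoffel h) (Φ y) ∘L fderiv ℝ Φ y :=
    fderiv_comp y (hh.christoffel_differentiableAt (hΦ.mapsTo hy)) (hΦ.differentiableAt hy)
  have h1 : DifferentiableAt ℝ (fderiv ℝ Z) y :=
    (hZ.fderiv_right (m := ∞) (by simp)).differentiableAt (by simp)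
  have h2 : DifferentiableAt ℝ (fun z => christoffel h (Φ z)) y :=
    (hh.christoffel_differentiableAt (hΦ.mapsTo hy)).comp y (hΦ.differentiableAt hy)
  have hZd : DifferentiableAt ℝ Z y := hZ.differentiableAt (by simp)
  -- Apart from the derivative of `Γ` and the composite `Γ ∘ Γ`, every term of this expansion is
  -- symmetric in `u, v` or paired with its mirror image, and drops out of the commutator.
  have key (u v : E) : covAlong h Φ (fun z => covAlong h Φ Z z v) y u =
      fderiv ℝ (fderiv ℝ Z) y u v
      + (fderiv ℝ (christoffel h) (Φ y) (fderiv ℝ Φ y u) (fderiv ℝ Φ y v) (Z y)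
        + christoffel h (Φ y) (fderiv ℝ (fderiv ℝ Φ) y u v) (Z y)
        + christoffel h (Φ y) (fderiv ℝ Φ y v) (fderiv ℝ Z y u))
      + christoffel h (Φ y) (fderiv ℝ Φ y u)
          (fderiv ℝ Z y v + christoffel h (Φ y) (fderiv ℝ Φ y v) (Z y)) := by
    have e1 : DifferentiableAt ℝ (fun z => fderiv ℝ Z z v) y :=
      h1.clm_apply (differentiableAt_const v)
    have e2 : DifferentiableAt ℝ (fun z => fderiv ℝ Φ z v) y :=
      (hΦ.fderiv_differentiableAt hy).clm_apply (differentiableAt_const v)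
    have e3 : DifferentiableAt ℝ (fun z => christoffel h (Φ z) (fderiv ℝ Φ z v) (Z z)) y :=
      (h2.clm_apply e2).clm_apply hZd
    conv_lhs => rw [covAlong]
    have : (fun z => covAlong h Φ Z z v) =
      (fun z => fderiv ℝ Z z v) + fun z => christoffel h (Φ z) (fderiv ℝ Φ z v) (Z z) := rfl
    rw [this, fderiv_add e1 e3, add_apply, fderiv_fderiv_apply hZ,
      fderiv_bilin (b := fun z => christoffel h (Φ z)) h2 e2 hZd, hc,
      fderiv_fderiv_apply (hΦ.contDiffAt hy)]
    rfl
  rw [key, key, snd_fderiv_comm hZ u v, snd_fderiv_comm (hΦ.contDiffAt hy) u v, curvature]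
  simp only [map_add, add_apply, sub_apply,
    ContinuousLinearMap.comp_apply]
  abel

theorem covAlong_add {X Y : E → F} {y : E} (hX : DifferentiableAt ℝ X y)
    (hY : DifferentiableAt ℝ Y y) (u : E) :
    covAlong h Φ (fun z => X z + Y z) y u = covAlong h Φ X y u + covAlong h Φ Y y u := by
  have : (fun z => X z + Y z) = X + Y := rfl
  rw [covAlong, this, fderiv_add hX hY]
  simp only [covAlong, add_apply, map_add]
  abel

theorem covAlong_smul {a : E → ℝ} {X : E → F} {y : E} (ha : DifferentiableAt ℝ a y)
    (hX : DifferentiableAt ℝ X y) (u : E) :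
    covAlong h Φ (fun z => a z • X z) y u = a y • covAlong h Φ X y u + fderiv ℝ a y u • X y := by
  rw [covAlong, fderiv_fun_smul ha hX]
  simp [covAlong]
  abel

theorem covAlong_congr {X Y : E → F} {y : E} (hXY : X =ᶠ[nhds y] Y) (u : E) :
    covAlong h Φ X y u = covAlong h Φ Y y u := by
  rw [covAlong, covAlong, hXY.fderiv_eq, hXY.eq_of_nhds]

end Along

/-! ### Symmetries of the curvature tensor -/

section Ambient

variable {F : Type*} [NormedAddCommGroup F] [NormedSpace ℝ F] [FiniteDimensional ℝ F]
  {h : F → F →L[ℝ] F →L[ℝ] ℝ} {t : Set F}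

omit [FiniteDimensional ℝ F] in
theorem curvature_swap (h : F → F →L[ℝ] F →L[ℝ] ℝ) (y u v w : F) :
    curvature h y u v w = -curvature h y v u w := by
  simp [curvature]
  abel

theorem IsMetricOn.curvature_eq_covAlong (hh : IsMetricOn h t) {y : F} (hy : y ∈ t) (u v w : F) :
    curvature h y u v w =
      covAlong h (fun z => z) (fun z => christoffel h z v w) y u
        - covAlong h (fun z => z) (fun z => christoffel h z u w) y v := by
  have := covAlong_covAlong_sub hh (isImmersionOn_id hh.isOpen) hy
    (contDiffAt_const (c := w)) u v
  simpa [covAlong] using this.symm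

/-- The second derivatives of the function `h(w, z)`, with `w, z` constant, commute. Expanded by
metric compatibility, the mixed terms are symmetric in the two directions, and what remains is `h(R
w, z) + h(w, R z) = 0`. -/
theorem IsMetricOn.curvature_skew (hh : IsMetricOn h t) {y : F} (hy : y ∈ t) (u v w z : F) :
    h y (curvature h y u v w) z = -h y (curvature h y u v z) w := by
  have hid := isImmersionOn_id hh.isOpen
  have hG (v w : F) {x : F} (hx : x ∈ t) : ContDiffAt ℝ ∞ (fun z => christoffel h z v w) x :=
    ((hh.christoffel_contDiffAt hx).clm_apply contDiffAt_const).clm_apply contDiffAt_const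
  have hGd (v w : F) {x : F} (hx : x ∈ t) :
      DifferentiableAt ℝ (fun z => christoffel h z v w) x :=
    (hG v w hx).differentiableAt (by simp)
  have hS : ContDiffAt ℝ ∞ (fun x => h x w z) y :=
    ((hh.contDiffAt hy).clm_apply contDiffAt_const).clm_apply contDiffAt_const
  have key (u v : F) : fderiv ℝ (fun x => fderiv ℝ (fun x => h x w z) x v) y u =
      h y (covAlong h (fun z => z) (fun z => christoffel h z v w) y u) z
      + h y (christoffel h y v w) (christoffel h y u z)
      + (h y (christoffel h y u w) (christoffel h y v z)
      + h y w (covAlong h (fun z => z) (fun x => christoffel h x v z) y u)) := by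
    have h1 : (fun x => fderiv ℝ (fun x => h x w z) x v) =ᶠ[nhds y]
        (fun x => h x (christoffel h x v w) z) + fun x => h x w (christoffel h x v z) := by
      filter_upwards [hh.isOpen.mem_nhds hy] with x hx
      have := fderiv_metric_along hh hid hx (differentiableAt_const w) (differentiableAt_const z) v
      simpa [covAlong] using this
    have d1 : DifferentiableAt ℝ (fun x => h x (christoffel h x v w) z) y :=
      ((hh.differentiableAt hy).clm_apply (hGd v w hy)).clm_apply (differentiableAt_const z)
    have d2 : DifferentiableAt ℝ (fun x => h x w (christoffel h x v z)) y :=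
      ((hh.differentiableAt hy).clm_apply (differentiableAt_const w)).clm_apply (hGd v z hy)
    rw [h1.fderiv_eq, fderiv_add d1 d2, add_apply,
      fderiv_metric_along hh hid hy (hGd v w hy) (differentiableAt_const z) u,
      fderiv_metric_along hh hid hy (differentiableAt_const w) (hGd v z hy) u]
    simp [covAlong]
  have hsymm := snd_fderiv_comm hS u v
  rw [← fderiv_fderiv_apply hS, ← fderiv_fderiv_apply hS, key, key] at hsymm
  rw [hh.symm y hy _ w, hh.curvature_eq_covAlong hy, hh.curvature_eq_covAlong hy]
  simp only [map_sub, sub_apply]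
  linarith

theorem IsMetricOn.fderiv_christoffel_comm (hh : IsMetricOn h t) {y : F} (hy : y ∈ t)
    (u v w : F) : fderiv ℝ (christoffel h) y u v w = fderiv ℝ (christoffel h) y u w v := by
  have hd := hh.christoffel_differentiableAt hy
  have h1 := fderiv_bilin hd (differentiableAt_const v) (differentiableAt_const w) u
  have h2 := fderiv_bilin hd (differentiableAt_const w) (differentiableAt_const v) u
  have h3 : (fun z => christoffel h z v w) =ᶠ[nhds y] fun z => christoffel h z w v := by
    filter_upwards [hh.isOpen.mem_nhds hy] with z hz using hh.christoffel_comm hz v w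
  rw [h3.fderiv_eq, h2] at h1
  simpa using h1.symm

/-- The first Bianchi identity. -/
theorem IsMetricOn.curvature_bianchi (hh : IsMetricOn h t) {y : F} (hy : y ∈ t) (u v w : F) :
    curvature h y u v w + curvature h y v w u + curvature h y w u v = 0 := by
  simp only [curvature, add_apply, sub_apply,
    ContinuousLinearMap.comp_apply]
  rw [hh.fderiv_christoffel_comm hy u v w, hh.fderiv_christoffel_comm hy v w u,
    hh.fderiv_christoffel_comm hy w u v, hh.christoffel_comm hy v w, hh.christoffel_comm hy u w,
    hh.christoffel_comm hy v u]
  abel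

/-- The curvature commutes with a constant endomorphism that is parallel. -/
theorem IsMetricOn.curvature_parallel (hh : IsMetricOn h t) (J : F →L[ℝ] F)
    (hJ : ∀ z ∈ t, ∀ u v, christoffel h z u (J v) = J (christoffel h z u v))
    {y : F} (hy : y ∈ t) (u v w : F) :
    curvature h y u v (J w) = J (curvature h y u v w) := by
  have hd := hh.christoffel_differentiableAt hy
  have key (u v w : F) : fderiv ℝ (christoffel h) y u v (J w) =
      J (fderiv ℝ (christoffel h) y u v w) := by
    have h1 := fderiv_bilin hd (differentiableAt_const v) (differentiableAt_const (J w)) u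
    have h2 := fderiv_bilin hd (differentiableAt_const v) (differentiableAt_const w) u
    have h3 : (fun z => christoffel h z v (J w)) =ᶠ[nhds y]
        fun z => J (christoffel h z v w) := by
      filter_upwards [hh.isOpen.mem_nhds hy] with z hz using hJ z hz v w
    have hcd : DifferentiableAt ℝ (fun z => christoffel h z v w) y :=
      (hd.clm_apply (differentiableAt_const v)).clm_apply (differentiableAt_const w)
    have h4 := fderiv_lin (differentiableAt_const J) hcd u
    rw [h3.fderiv_eq, h4, h2] at h1
    simpa using h1.symm
  simp [curvature, key, hJ y hy]

end Ambient

/-! ### Algebraic Kähler curvature tensors -/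

section CurvatureLike

/-- A quadrilinear form with the symmetries of a Kähler curvature tensor vanishes if its holomorphic
sectional curvature does. -/
theorem eq_zero_of_holomorphic_sectional_eq_zero {F : Type*} [AddCommGroup F] (J : F →+ F)
    (hJ : ∀ x, J (J x) = -x) (T : F → F → F → F → ℝ)
    (add_left : ∀ u u' v w z, T (u + u') v w z = T u v w z + T u' v w z)
    (swap : ∀ u v w z, T u v w z = -T v u w z)
    (skew : ∀ u v w z, T u v w z = -T u v z w)
    (bianchi : ∀ u v w z, T u v w z + T v w u z + T w u v z = 0)
    (inv : ∀ u v w z, T u v (J w) (J z) = T u v w z)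
    (hol : ∀ u, T u (J u) (J u) u = 0) (u v w z : F) : T u v w z = 0 := by
  -- The usual octahedron argument: four Bianchi identities combined with the two antisymmetries.
  have pair (u v w z : F) : T u v w z = T w z u v := by
    linarith [bianchi u v w z, bianchi v w z u, bianchi w z u v, bianchi z u v w,
      swap w u v z, skew v w z u, skew z v w u, skew w z u v,
      swap u w z v, skew u z v w, swap z u v w, skew u v z w, swap v z u w, swap z v w u,
      skew w u v z, skew v w u z, skew z u v w, skew u w z v, swap u z v w, skew v z u w]
  have inv' (u v w z : F) : T (J u) (J v) w z = T u v w z := by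
    rw [pair, inv, pair]
  have add_right (u v v' w z : F) : T u (v + v') w z = T u v w z + T u v' w z := by
    rw [swap, add_left, swap v, swap v']
    ring
  have add_three (u v w w' z : F) : T u v (w + w') z = T u v w z + T u v w' z := by
    rw [pair, add_left, pair w, pair w']
  have add_four (u v w z z' : F) : T u v w (z + z') = T u v w z + T u v w z' := by
    rw [skew, add_three, skew _ _ z, skew _ _ z']
    ring
  have neg_left (u v w z : F) : T (-u) v w z = -T u v w z := by
    have h0 := add_left 0 0 v w z
    have h1 := add_left u (-u) v w z
    simp only [add_zero, add_neg_cancel] at h0 h1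
    linarith
  have neg_right (u v w z : F) : T u (-v) w z = -T u v w z := by
    rw [swap, neg_left, swap v u, neg_neg]
  have neg_three (u v w z : F) : T u v (-w) z = -T u v w z := by
    rw [pair, neg_left, pair w]
  have neg_four (u v w z : F) : T u v w (-z) = -T u v w z := by
    rw [skew, neg_three, skew u v z, neg_neg]
  have hol' (x : F) : T x (J x) x (J x) = 0 := by rw [skew, hol, neg_zero]
  -- The part of the holomorphic condition quadratic in `y`, isolated by adding its values at `x +
  -- y` and `x - y`; four of its six terms coincide by `J`-invariance.
  have mixed (x y : F) : T x (J x) y (J y) + 2 * T x (J y) x (J y) = 0 := by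
    have h1 := hol' (x + y)
    have h2 := hol' (x + -y)
    simp only [map_add, map_neg, add_left, add_right, add_three, add_four, neg_left, neg_right,
      neg_three, neg_four] at h1 h2
    have e (w z : F) : T y (J x) w z = T x (J y) w z := by
      rw [← inv' y (J x), hJ, neg_right, swap, neg_neg]
    have e' (w z : F) : T w z y (J x) = T w z x (J y) := by
      rw [pair, e, pair]
    have := pair y (J y) x (J x)
    simp only [e, e', hol'] at h1 h2
    linarith
  have sec (x y : F) : T x y x y = 0 := by
    -- Bianchi on `x, Jx, y` rewrites the first term of `mixed`. Replacing `y` by `Jy` then gives a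
    -- second relation, and the system with rows `(1, 3)` and `(3, 1)` is nonsingular.
    have key (x y : F) : T x y x y + 3 * T x (J y) x (J y) = 0 := by
      have h1 := bianchi x (J x) y (J y)
      have e1 : T (J x) y x (J y) = -T x (J y) x (J y) := by
        rw [← inv' (J x) y, hJ, neg_left]
      have e2 : T y x (J x) (J y) = -T x y x y := by rw [inv, swap]
      linarith [mixed x y]
    have h1 := key x y
    have h2 := key x (J y)
    rw [hJ, neg_right, neg_four, neg_neg] at h2
    linarith
  have sec' (x y z : F) : T x y x z = 0 := by
    have h1 := sec x (y + z)
    simp only [add_right, add_four, sec] at h1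
    linarith [pair x y x z]
  have alt (x y w z : F) : T x y w z = -T w y x z := by
    have h1 := sec' (x + w) y z
    simp only [add_left, add_three, sec'] at h1
    linarith
  -- By the antisymmetry in the first and third slots the three Bianchi terms are equal, so `3 T =
  -- 0`.
  linarith [bianchi u v w z, alt u v w z, swap w v u z, alt v w u z, swap u w v z]

/-- The value of the curvature tensor of constant holomorphic sectional curvature `c`. -/
theorem curvature_eq_of_holomorphic_sectional {F : Type*} [NormedAddCommGroup F] [NormedSpace ℝ F]
    (J : F →L[ℝ] F) (hJ : ∀ x, J (J x) = -x) (b : F →L[ℝ] F →L[ℝ] ℝ)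
    (symm : ∀ u v, b u v = b v u) (herm : ∀ u v, b (J u) (J v) = b u v)
    (R : F → F → F →L[ℝ] F) (c : ℝ)
    (add_left : ∀ u u' v w, R (u + u') v w = R u v w + R u' v w)
    (swap : ∀ u v w, R u v w = -R v u w)
    (skew : ∀ u v w z, b (R u v w) z = -b (R u v z) w)
    (bianchi : ∀ u v w, R u v w + R v w u + R w u v = 0)
    (inv : ∀ u v w, R u v (J w) = J (R u v w))
    (hol : ∀ u, b (R u (J u) (J u)) u = c * b u u ^ 2) (u v w z : F) :
    b (R u v w) z = c / 4 * (b v w * b u z - b u w * b v z + b (J v) w * b (J u) z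
      - b (J u) w * b (J v) z - 2 * b (J u) v * b (J w) z) := by
  have sk (u v : F) : b (J u) v = -b (J v) u := by
    rw [← herm (J u) v, hJ, symm]
    simp
  have sk' (u v : F) : b u (J v) = -b (J u) v := by
    rw [symm, sk]
  have sd (u : F) : b (J u) u = 0 := by linarith [sk u u]
  rw [← sub_eq_zero]
  -- The model tensor has the same symmetries and the same holomorphic sectional curvature, so the
  -- difference falls under the vanishing lemma.
  refine eq_zero_of_holomorphic_sectional_eq_zero (J : F →+ F) hJ (fun u v w z => b (R u v w) z -
    c / 4 * (b v w * b u z - b u w * b v z + b (J v) w * b (J u) z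
      - b (J u) w * b (J v) z - 2 * b (J u) v * b (J w) z)) ?_ ?_ ?_ ?_ ?_ ?_ u v w z
  · intro u u' v w z
    simp only [add_left, map_add, add_apply]
    ring
  · intro u v w z
    simp only [swap u v, map_neg, neg_apply]
    rw [sk u v]
    ring
  · intro u v w z
    simp only [skew u v w]
    rw [sk w z]
    ring
  · intro u v w z
    have h1 : b (R u v w) z + b (R v w u) z + b (R w u v) z = 0 := by
      rw [← add_apply, ← add_apply, ← map_add, ← map_add, bianchi]
      simp
    rw [sk v u, sk w u, sk w v, symm v w, symm u w, symm v u]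
    linear_combination h1
  · intro u v w z
    simp only [AddMonoidHom.coe_coe, inv, herm, sk', hJ, map_neg, neg_apply]
    ring
  · intro u
    simp only [AddMonoidHom.coe_coe, hol, sk', sd, hJ, map_neg, neg_apply]
    ring

end CurvatureLike

theorem contDiffAt_bilinearComp {D E E' F F' G : Type*} [NormedAddCommGroup D] [NormedSpace ℝ D]
    [NormedAddCommGroup E] [NormedSpace ℝ E] [NormedAddCommGroup E'] [NormedSpace ℝ E']
    [NormedAddCommGroup F] [NormedSpace ℝ F] [NormedAddCommGroup F'] [NormedSpace ℝ F']
    [NormedAddCommGroup G] [NormedSpace ℝ G]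
    {b : D → F →L[ℝ] F' →L[ℝ] G} {X : D → E →L[ℝ] F} {Y : D → E' →L[ℝ] F'} {y : D}
    (hb : ContDiffAt ℝ ∞ b y) (hX : ContDiffAt ℝ ∞ X y) (hY : ContDiffAt ℝ ∞ Y y) :
    ContDiffAt ℝ ∞ (fun z => (b z).bilinearComp (X z) (Y z)) y := by
  have h1 := (ContinuousLinearMap.flipₗᵢ ℝ E F' G).toContinuousLinearEquiv.contDiff.contDiffAt.comp
    y (hb.clm_comp hX)
  exact (ContinuousLinearMap.flipₗᵢ ℝ E' E G).toContinuousLinearEquiv.contDiff.contDiffAt.comp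
    y (h1.clm_comp hY)

@[simp]
theorem cplxJ_apply {F : Type*} [NormedAddCommGroup F] [NormedSpace ℂ F] (z : F) :
    cplxJ F z = Complex.I • z := rfl

theorem cplxJ_cplxJ {F : Type*} [NormedAddCommGroup F] [NormedSpace ℂ F] (z : F) :
    cplxJ F (cplxJ F z) = -z := by
  simp [smul_smul]

/-! ### Almost contact structure, Gauss and Weingarten formulas, Codazzi equation -/

section Hypersurface

variable {E : Type*} [NormedAddCommGroup E] [NormedSpace ℝ E] [FiniteDimensional ℝ E]
  {F : Type*} [NormedAddCommGroup F] [NormedSpace ℂ F] [FiniteDimensional ℂ F]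

/-- `Φ` parametrizes a real hypersurface in the Kähler metric `h`. -/
structure IsHypersurfaceOn (h : F → F →L[ℝ] F →L[ℝ] ℝ) (Φ : E → F) (s : Set E) (t : Set F) :
    Prop where
  metric : IsMetricOn h t
  imm : IsImmersionOn Φ s t
  herm : ∀ z ∈ t, ∀ u v, h z (cplxJ F u) (cplxJ F v) = h z u v
  parallel : ∀ z ∈ t, ∀ u v, christoffel h z u (cplxJ F v) = cplxJ F (christoffel h z u v)
  codim : finrank ℝ F = finrank ℝ E + 1

variable {h : F → F →L[ℝ] F →L[ℝ] ℝ} {Φ : E → F} {s : Set E} {t : Set F}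

omit [FiniteDimensional ℝ E] [FiniteDimensional ℂ F] in
theorem inducedMetric_apply (y u v : E) :
    inducedMetric h Φ y u v = h (Φ y) (fderiv ℝ Φ y u) (fderiv ℝ Φ y v) := rfl

namespace IsHypersurfaceOn

variable (H : IsHypersurfaceOn h Φ s t)
include H

omit [FiniteDimensional ℝ E] [FiniteDimensional ℂ F] in
theorem metric_contDiffAt {y : E} (hy : y ∈ s) : ContDiffAt ℝ ∞ (fun z => h (Φ z)) y :=
  (H.metric.contDiffAt (H.imm.mapsTo hy)).comp y (H.imm.contDiffAt hy)

omit [FiniteDimensional ℝ E] [FiniteDimensional ℂ F] in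
theorem induced : IsMetricOn (inducedMetric h Φ) s where
  isOpen := H.imm.isOpen
  smooth _ hy := (contDiffAt_bilinearComp (H.metric_contDiffAt hy) (H.imm.fderiv_contDiffAt hy)
    (H.imm.fderiv_contDiffAt hy)).contDiffWithinAt
  symm _ hy _ _ := H.metric.symm _ (H.imm.mapsTo hy) _ _
  pos y hy _ hu := H.metric.pos _ (H.imm.mapsTo hy) _ fun h0 =>
    hu (H.imm.inj y hy (h0.trans (map_zero _).symm))

omit [FiniteDimensional ℂ F] in
theorem inducedMetric_tangPart {y : E} (hy : y ∈ s) (z : F) (v : E) :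
    inducedMetric h Φ y (tangPart h Φ y z) v = h (Φ y) z (fderiv ℝ Φ y v) := by
  simp [tangPart, H.induced.apply_inverse hy]

omit [FiniteDimensional ℂ F] in
theorem tangPart_contDiffAt {y : E} (hy : y ∈ s) : ContDiffAt ℝ ∞ (tangPart h Φ) y :=
  (H.induced.contDiffAt_inverse hy).clm_comp
    (contDiffAt_bilinearComp (H.metric_contDiffAt hy) contDiffAt_const (H.imm.fderiv_contDiffAt hy))

theorem tangPart_fderiv {y : E} (hy : y ∈ s) (u : E) : tangPart h Φ y (fderiv ℝ Φ y u) = u :=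
  H.induced.ext hy fun w => by rw [H.inducedMetric_tangPart hy, inducedMetric_apply]

theorem tangPart_normal {y : E} (hy : y ∈ s) {ν : F} (hν : IsUnitNormal h Φ y ν) :
    tangPart h Φ y ν = 0 :=
  H.induced.ext hy fun w => by rw [H.inducedMetric_tangPart hy, hν.1]; simp

/-- The map `(u, r) ↦ dΦ u + rν` is injective by orthogonality, hence onto because the codimension
is one; pairing with tangent vectors and with `ν` identifies the coefficients. -/
theorem decomp {y : E} (hy : y ∈ s) {ν : F} (hν : IsUnitNormal h Φ y ν) (z : F) :
    z = fderiv ℝ Φ y (tangPart h Φ y z) + h (Φ y) z ν • ν := by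
  have hs := H.metric.symm _ (H.imm.mapsTo hy)
  let L : E × ℝ →ₗ[ℝ] F :=
    (fderiv ℝ Φ y : E →ₗ[ℝ] F).coprod (LinearMap.toSpanSingleton ℝ F ν)
  have hL (x : E × ℝ) : L x = fderiv ℝ Φ y x.1 + x.2 • ν := by simp [L]
  have hinj : Function.Injective L := by
    rw [← LinearMap.ker_eq_bot, LinearMap.ker_eq_bot']
    rintro ⟨u, r⟩ h0
    rw [hL] at h0
    have hr : r = 0 := by
      have h1 : h (Φ y) (fderiv ℝ Φ y u + r • ν) ν = 0 := by simp only at h0; rw [h0]; simp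
      rw [map_add, add_apply, hs _ ν, hν.1] at h1
      simpa [hν.2] using h1
    have hu : u = 0 := H.imm.inj y hy (by simpa [hr] using h0)
    simp [hu, hr]
  have hsurj : Function.Surjective L := by
    refine (LinearMap.injective_iff_surjective_of_finrank_eq_finrank ?_).1 hinj
    rw [H.codim, finrank_prod, finrank_self]
  obtain ⟨⟨u, r⟩, rfl⟩ := hsurj z
  rw [hL]
  simp only [map_add, map_smul, H.tangPart_fderiv hy, H.tangPart_normal hy hν, add_apply,
    smul_apply, hν.2, hs _ ν, hν.1]
  simp

theorem ext_normal {y : E} (hy : y ∈ s) {ν : F} (hν : IsUnitNormal h Φ y ν) {z z' : F}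
    (h1 : ∀ w, h (Φ y) z (fderiv ℝ Φ y w) = h (Φ y) z' (fderiv ℝ Φ y w))
    (h2 : h (Φ y) z ν = h (Φ y) z' ν) : z = z' := by
  rw [H.decomp hy hν z, H.decomp hy hν z', h2]
  congr 2
  exact H.induced.ext hy fun w => by
    rw [H.inducedMetric_tangPart hy, H.inducedMetric_tangPart hy, h1]

omit [FiniteDimensional ℝ E] [FiniteDimensional ℂ F] in
theorem skew_J {y : E} (hy : y ∈ s) (u v : F) :
    h (Φ y) (cplxJ F u) v = -h (Φ y) u (cplxJ F v) := by
  rw [← H.herm _ (H.imm.mapsTo hy) u, cplxJ_cplxJ, map_neg, neg_neg]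

omit [FiniteDimensional ℝ E] [FiniteDimensional ℂ F] in
theorem metric_J_self {y : E} (hy : y ∈ s) (u : F) : h (Φ y) (cplxJ F u) u = 0 := by
  have h1 := H.skew_J hy u u
  rw [H.metric.symm _ (H.imm.mapsTo hy) u] at h1
  linarith

theorem fderiv_xi {y : E} (hy : y ∈ s) {ν : F} (hν : IsUnitNormal h Φ y ν) :
    fderiv ℝ Φ y (xi h Φ y ν) = -cplxJ F ν := by
  have h1 := H.decomp hy hν (-cplxJ F ν)
  have h2 : h (Φ y) (-cplxJ F ν) ν = 0 := by rw [map_neg, neg_apply, H.metric_J_self hy, neg_zero]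
  rw [h2, zero_smul, add_zero] at h1
  exact h1.symm

/-- The normal component is `h(J dΦ u, ν) = -h(dΦ u, Jν) = g(u, ξ)`, because `dΦ ξ = -Jν`. -/
theorem J_fderiv {y : E} (hy : y ∈ s) {ν : F} (hν : IsUnitNormal h Φ y ν) (u : E) :
    cplxJ F (fderiv ℝ Φ y u) =
      fderiv ℝ Φ y (phi h Φ y u) + inducedMetric h Φ y u (xi h Φ y ν) • ν := by
  have h1 := H.decomp hy hν (cplxJ F (fderiv ℝ Φ y u))
  rw [H.skew_J hy, ← map_neg, ← H.fderiv_xi hy hν] at h1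
  exact h1

theorem phi_xi {y : E} (hy : y ∈ s) {ν : F} (hν : IsUnitNormal h Φ y ν) :
    phi h Φ y (xi h Φ y ν) = 0 := by
  have : phi h Φ y (xi h Φ y ν) = tangPart h Φ y (cplxJ F (fderiv ℝ Φ y (xi h Φ y ν))) := rfl
  rw [this, H.fderiv_xi hy hν, map_neg, cplxJ_cplxJ, neg_neg, H.tangPart_normal hy hν]

theorem metric_xi_xi {y : E} (hy : y ∈ s) {ν : F} (hν : IsUnitNormal h Φ y ν) :
    inducedMetric h Φ y (xi h Φ y ν) (xi h Φ y ν) = 1 := by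
  rw [inducedMetric_apply, H.fderiv_xi hy hν, ← map_neg, H.herm _ (H.imm.mapsTo hy), map_neg,
    map_neg, neg_apply, neg_neg, hν.2]

theorem metric_phi {y : E} (hy : y ∈ s) (u v : E) :
    inducedMetric h Φ y (phi h Φ y u) v =
      h (Φ y) (cplxJ F (fderiv ℝ Φ y u)) (fderiv ℝ Φ y v) := by
  rw [phi, ContinuousLinearMap.comp_apply, H.inducedMetric_tangPart hy]
  rfl

theorem phi_skew {y : E} (hy : y ∈ s) (u v : E) :
    inducedMetric h Φ y (phi h Φ y u) v = -inducedMetric h Φ y u (phi h Φ y v) := by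
  rw [H.metric_phi hy, H.skew_J hy, H.induced.symm y hy u, H.metric_phi hy,
    H.metric.symm _ (H.imm.mapsTo hy)]

theorem metric_phi_self {y : E} (hy : y ∈ s) (u : E) :
    inducedMetric h Φ y (phi h Φ y u) u = 0 := by
  rw [H.metric_phi hy, H.metric_J_self hy]

theorem metric_phi_xi {y : E} (hy : y ∈ s) {ν : F} (hν : IsUnitNormal h Φ y ν) (u : E) :
    inducedMetric h Φ y (phi h Φ y u) (xi h Φ y ν) = 0 := by
  rw [H.phi_skew hy, H.phi_xi hy hν]; simp

/-- Apply `J` once more to the decomposition of `J dΦ u`: `φu ⟂ ξ` leaves `J dΦ(φu)` without normal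
part, and `Jν = -dΦ ξ`. -/
theorem phi_phi {y : E} (hy : y ∈ s) {ν : F} (hν : IsUnitNormal h Φ y ν) (u : E) :
    phi h Φ y (phi h Φ y u) = -u + inducedMetric h Φ y u (xi h Φ y ν) • xi h Φ y ν := by
  have h1 := congrArg (cplxJ F) (H.J_fderiv hy hν u)
  rw [map_add, cplxJ_cplxJ, H.J_fderiv hy hν (phi h Φ y u), H.metric_phi_xi hy hν, zero_smul,
    add_zero, map_smul, ← neg_neg (cplxJ F ν), ← H.fderiv_xi hy hν] at h1
  apply H.imm.inj y hy
  simp only [map_add, map_neg, map_smul]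
  rw [h1]
  module

theorem phi_contDiffAt {y : E} (hy : y ∈ s) : ContDiffAt ℝ ∞ (phi h Φ) y :=
  (H.tangPart_contDiffAt hy).clm_comp (contDiffAt_const.clm_comp (H.imm.fderiv_contDiffAt hy))

omit [FiniteDimensional ℝ E] in
theorem ambientDeriv_comm {y : E} (hy : y ∈ s) (u v : E) :
    ambientDeriv h Φ y u v = ambientDeriv h Φ y v u := by
  simp only [ambientDeriv, add_apply, ContinuousLinearMap.bilinearComp_apply]
  rw [snd_fderiv_comm (H.imm.contDiffAt hy) u v,
    H.metric.christoffel_comm (H.imm.mapsTo hy)]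

omit [FiniteDimensional ℝ E] in
theorem ambientDeriv_contDiffAt {y : E} (hy : y ∈ s) : ContDiffAt ℝ ∞ (ambientDeriv h Φ) y := by
  have h2 : ContDiffAt ℝ ∞ (fun z => christoffel h (Φ z)) y :=
    (H.metric.christoffel_contDiffAt (H.imm.mapsTo hy)).comp y (H.imm.contDiffAt hy)
  exact ((H.imm.fderiv_contDiffAt hy).fderiv_right (by simp)).add
    (contDiffAt_bilinearComp h2 (H.imm.fderiv_contDiffAt hy) (H.imm.fderiv_contDiffAt hy))

omit [FiniteDimensional ℝ E] [FiniteDimensional ℂ F] in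
theorem covAlong_fderiv_const {y : E} (hy : y ∈ s) (u v : E) :
    covAlong h Φ (fun z => fderiv ℝ Φ z v) y u = ambientDeriv h Φ y u v := by
  rw [covAlong, fderiv_fderiv_apply (H.imm.contDiffAt hy)]
  rfl

omit [FiniteDimensional ℝ E] [FiniteDimensional ℂ F] in
theorem covAlong_fderiv {y : E} (hy : y ∈ s) {X : E → E} (hX : DifferentiableAt ℝ X y) (u : E) :
    covAlong h Φ (fun z => fderiv ℝ Φ z (X z)) y u =
      fderiv ℝ Φ y (fderiv ℝ X y u) + ambientDeriv h Φ y u (X y) := by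
  rw [covAlong, fderiv_lin (H.imm.fderiv_differentiableAt hy) hX]
  simp only [ambientDeriv, add_apply, ContinuousLinearMap.bilinearComp_apply]
  abel

omit [FiniteDimensional ℝ E] in
theorem fderiv_inducedMetric {y : E} (hy : y ∈ s) (u v w : E) :
    fderiv ℝ (inducedMetric h Φ) y u v w =
      h (Φ y) (ambientDeriv h Φ y u v) (fderiv ℝ Φ y w)
        + h (Φ y) (fderiv ℝ Φ y v) (ambientDeriv h Φ y u w) := by
  have hd (v : E) : DifferentiableAt ℝ (fun z => fderiv ℝ Φ z v) y :=
    (H.imm.fderiv_differentiableAt hy).clm_apply (differentiableAt_const v)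
  have h1 := fderiv_metric_along H.metric H.imm hy (hd v) (hd w) u
  have h2 := fderiv_bilin (H.induced.differentiableAt hy) (differentiableAt_const v)
    (differentiableAt_const w) u
  rw [H.covAlong_fderiv_const hy, H.covAlong_fderiv_const hy] at h1
  rw [← h1]
  simp only [fderiv_fun_const, Pi.zero_apply, zero_apply, map_zero, add_zero] at h2
  exact h2.symm

/-- The tangential part of the Gauss formula. -/
theorem metric_ambientDeriv {y : E} (hy : y ∈ s) (u v w : E) :
    h (Φ y) (ambientDeriv h Φ y u v) (fderiv ℝ Φ y w) =
      inducedMetric h Φ y (christoffel (inducedMetric h Φ) y u v) w := by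
  have hs := H.metric.symm _ (H.imm.mapsTo hy)
  -- The ambient derivative is symmetric and compatible with `h`, so its tangential part satisfies
  -- the Koszul formula of the induced metric.
  rw [H.induced.christoffel_apply hy, H.fderiv_inducedMetric hy, H.fderiv_inducedMetric hy,
    H.fderiv_inducedMetric hy, H.ambientDeriv_comm hy w u, H.ambientDeriv_comm hy w v,
    H.ambientDeriv_comm hy v u, hs (fderiv ℝ Φ y v), hs (fderiv ℝ Φ y u)]
  ring

omit [FiniteDimensional ℂ F] in
theorem metric_shape {y : E} (hy : y ∈ s) (ν : F) (u v : E) :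
    inducedMetric h Φ y (shape h Φ y ν u) v = h (Φ y) ν (ambientDeriv h Φ y u v) := by
  simp [shape, H.induced.apply_inverse hy]

theorem shape_symm {y : E} (hy : y ∈ s) (ν : F) (u v : E) :
    inducedMetric h Φ y (shape h Φ y ν u) v = inducedMetric h Φ y u (shape h Φ y ν v) := by
  rw [H.induced.symm y hy u, H.metric_shape hy, H.metric_shape hy, H.ambientDeriv_comm hy]

/-- The Gauss formula. -/
theorem ambientDeriv_eq {y : E} (hy : y ∈ s) {ν : F} (hν : IsUnitNormal h Φ y ν) (u v : E) :
    ambientDeriv h Φ y u v = fderiv ℝ Φ y (christoffel (inducedMetric h Φ) y u v)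
      + inducedMetric h Φ y (shape h Φ y ν u) v • ν := by
  refine H.ext_normal hy hν (fun w => ?_) ?_
  · rw [H.metric_ambientDeriv hy, inducedMetric_apply]
    simp [hν.1]
  · rw [H.metric_shape hy, H.metric.symm _ (H.imm.mapsTo hy), map_add, add_apply,
      H.metric.symm _ (H.imm.mapsTo hy) _ ν, hν.1, map_smul, smul_apply, hν.2]
    simp

theorem shape_contDiffAt {y : E} (hy : y ∈ s) {n : E → F} (hn : ContDiffAt ℝ ∞ n y) :
    ContDiffAt ℝ ∞ (fun z => shape h Φ z (n z)) y :=
  (H.induced.contDiffAt_inverse hy).clm_comp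
    (((ContinuousLinearMap.compL ℝ E F ℝ).contDiff.contDiffAt.comp y
      ((H.metric_contDiffAt hy).clm_apply hn)).clm_comp (H.ambientDeriv_contDiffAt hy))

theorem xi_contDiffAt {y : E} (hy : y ∈ s) {n : E → F} (hn : ContDiffAt ℝ ∞ n y) :
    ContDiffAt ℝ ∞ (fun z => xi h Φ z (n z)) y :=
  (H.tangPart_contDiffAt hy).clm_apply ((cplxJ F).contDiff.contDiffAt.comp y hn).neg

theorem holPart_contDiffAt {y : E} (hy : y ∈ s) {n : E → F} (hn : ContDiffAt ℝ ∞ n y) :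
    ContDiffAt ℝ ∞ (fun z => holPart h Φ z (n z)) y := by
  have h1 := H.xi_contDiffAt hy hn
  have h2 := (H.shape_contDiffAt hy hn).clm_apply h1
  exact h2.sub ((((H.induced.contDiffAt hy).clm_apply h2).clm_apply h1).smul h1)

/-- Every unit normal vector extends to a smooth unit normal field. -/
theorem exists_normal_field {y : E} (hy : y ∈ s) {ν : F} (hν : IsUnitNormal h Φ y ν) :
    ∃ s' ⊆ s, y ∈ s' ∧ IsHypersurfaceOn h Φ s' t ∧ ∃ n : E → F, n y = ν ∧
      ContDiffOn ℝ ∞ n s' ∧ ∀ z ∈ s', IsUnitNormal h Φ z (n z) := by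
  -- The fixed vector `ν` minus its tangential part at `z`. At `y` this is `ν` itself, of norm one,
  -- so it can be normalised wherever its squared norm `q` stays positive.
  let m : E → F := fun z => ν - fderiv ℝ Φ z (tangPart h Φ z ν)
  have hm : ContDiffOn ℝ ∞ m s := fun z hz => (contDiffAt_const.sub
    ((H.imm.fderiv_contDiffAt hz).clm_apply
      ((H.tangPart_contDiffAt hz).clm_apply contDiffAt_const))).contDiffWithinAt
  let q : E → ℝ := fun z => h (Φ z) (m z) (m z)
  have hq : ContDiffOn ℝ ∞ q s := fun z hz =>
    ((((H.metric_contDiffAt hz).contDiffWithinAt).clm_apply (hm z hz)).clm_apply (hm z hz))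
  have hmy : m y = ν := by simp [m, H.tangPart_normal hy hν]
  have hqy : q y = 1 := by simp [q, hmy, hν.2]
  have hopen : IsOpen (s ∩ q ⁻¹' Set.Ioi 0) := hq.continuousOn.isOpen_inter_preimage H.imm.isOpen
    isOpen_Ioi
  refine ⟨s ∩ q ⁻¹' Set.Ioi 0, Set.inter_subset_left, ⟨hy, by simp [hqy]⟩,
    ⟨H.metric, ⟨hopen, H.imm.smooth.mono Set.inter_subset_left,
      H.imm.mapsTo.mono_left Set.inter_subset_left, fun z hz => H.imm.inj z hz.1⟩, H.herm,
      H.parallel, H.codim⟩,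
    fun z => (Real.sqrt (q z))⁻¹ • m z, by simp [hqy, hmy], ?_, ?_⟩
  · have hr : ContDiffOn ℝ ∞ (fun z => (Real.sqrt (q z))⁻¹) (s ∩ q ⁻¹' Set.Ioi 0) :=
      ((hq.mono Set.inter_subset_left).sqrt fun z hz => ne_of_gt hz.2).inv
        fun z hz => (Real.sqrt_pos.2 hz.2).ne'
    exact hr.smul (hm.mono Set.inter_subset_left)
  · rintro z ⟨hz, hqz⟩
    have hqz : 0 < q z := hqz
    refine ⟨fun u => ?_, ?_⟩
    · have h0 : h (Φ z) (m z) (fderiv ℝ Φ z u) = 0 := by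
        simp only [m, map_sub, sub_apply]
        rw [← inducedMetric_apply, H.inducedMetric_tangPart hz, sub_self]
      simp [h0]
    · have : h (Φ z) (m z) (m z) = q z := rfl
      simp only [map_smul, smul_apply, smul_eq_mul, this]
      rw [← mul_assoc, ← mul_inv, Real.mul_self_sqrt hqz.le, inv_mul_cancel₀ hqz.ne']

section NormalField

variable {n : E → F} (hn : ContDiffOn ℝ ∞ n s) (hν : ∀ z ∈ s, IsUnitNormal h Φ z (n z))
include hn hν

omit [FiniteDimensional ℝ E] [FiniteDimensional ℂ F] hν in
theorem normal_contDiffAt {y : E} (hy : y ∈ s) : ContDiffAt ℝ ∞ n y :=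
  hn.contDiffAt (H.imm.isOpen.mem_nhds hy)

/-- The Weingarten formula. -/
theorem covAlong_normal {y : E} (hy : y ∈ s) (u : E) :
    covAlong h Φ n y u = -fderiv ℝ Φ y (shape h Φ y (n y) u) := by
  have hs := H.metric.symm _ (H.imm.mapsTo hy)
  have hnd : DifferentiableAt ℝ n y := (H.normal_contDiffAt hn hy).differentiableAt (by simp)
  -- Differentiating `h(n, dΦ w) = 0` gives the tangential part, and `h(n, n) = 1` shows that there
  -- is no normal part.
  refine H.ext_normal hy (hν y hy) (fun w => ?_) ?_
  · have hd : DifferentiableAt ℝ (fun z => fderiv ℝ Φ z w) y :=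
      (H.imm.fderiv_differentiableAt hy).clm_apply (differentiableAt_const w)
    have h1 := fderiv_metric_along H.metric H.imm hy hnd hd u
    have h2 : (fun z => h (Φ z) (n z) (fderiv ℝ Φ z w)) =ᶠ[nhds y] fun _ => 0 := by
      filter_upwards [H.imm.isOpen.mem_nhds hy] with z hz using (hν z hz).1 w
    rw [h2.fderiv_eq, H.covAlong_fderiv_const hy, ← H.metric_shape hy, inducedMetric_apply] at h1
    rw [map_neg, neg_apply]
    simp at h1
    linarith
  · have h1 := fderiv_metric_along H.metric H.imm hy hnd hnd u
    have h2 : (fun z => h (Φ z) (n z) (n z)) =ᶠ[nhds y] fun _ => 1 := by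
      filter_upwards [H.imm.isOpen.mem_nhds hy] with z hz using (hν z hz).2
    rw [h2.fderiv_eq, hs (n y)] at h1
    rw [map_neg, neg_apply, hs (fderiv ℝ Φ y _) (n y), (hν y hy).1]
    simp at h1
    linarith

omit hν in
theorem shape_form_differentiableAt {y : E} (hy : y ∈ s) (v w : E) :
    DifferentiableAt ℝ (fun z => inducedMetric h Φ z (shape h Φ z (n z) v) w) y :=
  (((H.induced.contDiffAt hy).clm_apply ((H.shape_contDiffAt hy
    (H.normal_contDiffAt hn hy)).clm_apply contDiffAt_const)).clm_apply
      contDiffAt_const).differentiableAt (by simp)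

/-- The equations of Gauss and Codazzi. -/
theorem gauss_codazzi {y : E} (hy : y ∈ s) (u v w : E) :
    curvature h (Φ y) (fderiv ℝ Φ y u) (fderiv ℝ Φ y v) (fderiv ℝ Φ y w) =
      fderiv ℝ Φ y (curvature (inducedMetric h Φ) y u v w
        - inducedMetric h Φ y (shape h Φ y (n y) v) w • shape h Φ y (n y) u
        + inducedMetric h Φ y (shape h Φ y (n y) u) w • shape h Φ y (n y) v)
      + (fderiv ℝ (fun z => inducedMetric h Φ z (shape h Φ z (n z) v) w) y u
        - fderiv ℝ (fun z => inducedMetric h Φ z (shape h Φ z (n z) u) w) y v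
        + inducedMetric h Φ y (shape h Φ y (n y) u) (christoffel (inducedMetric h Φ) y v w)
        - inducedMetric h Φ y (shape h Φ y (n y) v) (christoffel (inducedMetric h Φ) y u w)) •
          n y := by
  have hnd : DifferentiableAt ℝ n y := (H.normal_contDiffAt hn hy).differentiableAt (by simp)
  have hZ : ContDiffAt ℝ ∞ (fun z => fderiv ℝ Φ z w) y :=
    (H.imm.fderiv_contDiffAt hy).clm_apply contDiffAt_const
  have hΓ := H.induced.christoffel_differentiableAt hy
  -- Differentiate the Gauss formula, with Weingarten for the derivative of `n`. In the commutator
  -- the terms with `Γ(u, v)` never arise, since `u, v` are constant coordinate fields.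
  have key (u v : E) : covAlong h Φ (fun z => covAlong h Φ (fun z => fderiv ℝ Φ z w) z v) y u =
      fderiv ℝ Φ y (fderiv ℝ (christoffel (inducedMetric h Φ)) y u v w)
      + ambientDeriv h Φ y u (christoffel (inducedMetric h Φ) y v w)
      + (inducedMetric h Φ y (shape h Φ y (n y) v) w •
          -fderiv ℝ Φ y (shape h Φ y (n y) u)
        + fderiv ℝ (fun z => inducedMetric h Φ z (shape h Φ z (n z) v) w) y u • n y) := by
    have hΓd : DifferentiableAt ℝ (fun z => christoffel (inducedMetric h Φ) z v w) y :=
      (hΓ.clm_apply (differentiableAt_const v)).clm_apply (differentiableAt_const w)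
    have h1 : (fun z => covAlong h Φ (fun z => fderiv ℝ Φ z w) z v) =ᶠ[nhds y]
        fun z => fderiv ℝ Φ z (christoffel (inducedMetric h Φ) z v w)
          + inducedMetric h Φ z (shape h Φ z (n z) v) w • n z := by
      filter_upwards [H.imm.isOpen.mem_nhds hy] with z hz
      rw [H.covAlong_fderiv_const hz, H.ambientDeriv_eq hz (hν z hz)]
    have hα := H.shape_form_differentiableAt hn hy v w
    have h2 := fderiv_bilin hΓ (differentiableAt_const v) (differentiableAt_const w) u
    simp only [fderiv_fun_const, Pi.zero_apply, zero_apply, map_zero, add_zero] at h2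
    rw [covAlong_congr h1, covAlong_add ((H.imm.fderiv_differentiableAt hy).clm_apply hΓd)
      (hα.fun_smul hnd), covAlong_smul hα hnd, H.covAlong_fderiv hy hΓd, H.covAlong_normal hn hν hy, h2]
  rw [← covAlong_covAlong_sub H.metric H.imm hy hZ, key, key, H.ambientDeriv_eq hy (hν y hy),
    H.ambientDeriv_eq hy (hν y hy), curvature]
  simp only [map_add, map_sub, map_smul, add_apply, sub_apply, ContinuousLinearMap.comp_apply]
  module

end NormalField

end IsHypersurfaceOn

end Hypersurface

/-! ### Hypersurfaces of complex space forms: Gauss equation and *-Ricci tensor -/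

section SpaceForm

variable {E : Type*} [NormedAddCommGroup E] [NormedSpace ℝ E] [FiniteDimensional ℝ E]
  {F : Type*} [NormedAddCommGroup F] [NormedSpace ℂ F] [FiniteDimensional ℂ F]
  {h : F → F →L[ℝ] F →L[ℝ] ℝ} {Φ : E → F} {s : Set E} {t : Set F} {c : ℝ}

namespace IsHypersurfaceOn

variable (H : IsHypersurfaceOn h Φ s t)
include H

theorem exists_unitNormal {y : E} (hy : y ∈ s) : ∃ ν, IsUnitNormal h Φ y ν := by
  have hlt : LinearMap.range (fderiv ℝ Φ y : E →ₗ[ℝ] F) < ⊤ := by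
    refine lt_top_iff_ne_top.2 fun htop => ?_
    have h1 := LinearMap.finrank_range_le (fderiv ℝ Φ y : E →ₗ[ℝ] F)
    rw [htop, finrank_top, H.codim] at h1
    omega
  obtain ⟨z, -, hz⟩ := SetLike.exists_of_lt hlt
  set m := z - fderiv ℝ Φ y (tangPart h Φ y z) with hm
  have hm0 : m ≠ 0 := fun h0 => hz ⟨tangPart h Φ y z, (sub_eq_zero.1 h0).symm⟩
  have hpos := H.metric.pos _ (H.imm.mapsTo hy) m hm0
  refine ⟨(Real.sqrt (h (Φ y) m m))⁻¹ • m, fun u => ?_, ?_⟩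
  · have h0 : h (Φ y) m (fderiv ℝ Φ y u) = 0 := by
      simp only [m, map_sub, sub_apply]
      rw [← inducedMetric_apply, H.inducedMetric_tangPart hy, sub_self]
    simp [h0]
  · simp only [map_smul, smul_apply, smul_eq_mul]
    rw [← mul_assoc, ← mul_inv, Real.mul_self_sqrt hpos.le, inv_mul_cancel₀ hpos.ne']

theorem ambient_curvature_eq
    (hol : ∀ z ∈ t, ∀ u, h z (curvature h z u (cplxJ F u) (cplxJ F u)) u = c * h z u u ^ 2)
    {y : E} (hy : y ∈ s) (u v w z : F) :
    h (Φ y) (curvature h (Φ y) u v w) z = c / 4 * (h (Φ y) v w * h (Φ y) u z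
      - h (Φ y) u w * h (Φ y) v z + h (Φ y) (cplxJ F v) w * h (Φ y) (cplxJ F u) z
      - h (Φ y) (cplxJ F u) w * h (Φ y) (cplxJ F v) z
      - 2 * h (Φ y) (cplxJ F u) v * h (Φ y) (cplxJ F w) z) := by
  have ht := H.imm.mapsTo hy
  refine curvature_eq_of_holomorphic_sectional (cplxJ F) cplxJ_cplxJ (h (Φ y))
    (H.metric.symm _ ht) (H.herm _ ht) (curvature h (Φ y)) c (fun u u' v w => ?_)
    (curvature_swap h (Φ y)) (H.metric.curvature_skew ht) (H.metric.curvature_bianchi ht)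
    (H.metric.curvature_parallel _ H.parallel ht) (hol _ ht) u v w z
  simp only [curvature, map_add, add_apply, sub_apply, ContinuousLinearMap.comp_apply]
  abel

section NormalField

variable {n : E → F} (hn : ContDiffOn ℝ ∞ n s) (hν : ∀ z ∈ s, IsUnitNormal h Φ z (n z))
  (hol : ∀ z ∈ t, ∀ u, h z (curvature h z u (cplxJ F u) (cplxJ F u)) u = c * h z u u ^ 2)
include hn hν hol

/-- The Gauss equation of a hypersurface in a complex space form. -/
theorem curvature_induced_eq {y : E} (hy : y ∈ s) (u v w : E) :
    curvature (inducedMetric h Φ) y u v w =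
      (c / 4) • (inducedMetric h Φ y v w • u - inducedMetric h Φ y u w • v
        + inducedMetric h Φ y (phi h Φ y v) w • phi h Φ y u
        - inducedMetric h Φ y (phi h Φ y u) w • phi h Φ y v
        - (2 * inducedMetric h Φ y (phi h Φ y u) v) • phi h Φ y w)
      + inducedMetric h Φ y (shape h Φ y (n y) v) w • shape h Φ y (n y) u
      - inducedMetric h Φ y (shape h Φ y (n y) u) w • shape h Φ y (n y) v := by
  refine H.induced.ext hy fun x => ?_
  have h1 := congrArg (fun z => h (Φ y) z (fderiv ℝ Φ y x)) (H.gauss_codazzi hn hν hy u v w)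
  simp only [H.ambient_curvature_eq hol hy, map_add (h (Φ y)), add_apply, map_smul (h (Φ y)),
    smul_apply, (hν y hy).1, smul_zero, add_zero, ← H.metric_phi hy, ← inducedMetric_apply] at h1
  simp only [map_add, map_sub, map_smul, add_apply, sub_apply, smul_apply, smul_eq_mul] at h1 ⊢
  linear_combination -h1

/-- The *-Ricci tensor of a hypersurface in a complex space form. -/
theorem starRic_eq {y : E} (hy : y ∈ s) (u v : E) :
    starRic h Φ y u v =
      c * (finrank ℝ E + 1) / 4 * inducedMetric h Φ y (phi h Φ y u) (phi h Φ y v)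
      + inducedMetric h Φ y (phi h Φ y (shape h Φ y (n y) u)) (shape h Φ y (n y) (phi h Φ y v)) := by
  set G := inducedMetric h Φ y with hG
  set φ := phi h Φ y with hφ
  set A := shape h Φ y (n y) with hA
  set ξ := xi h Φ y (n y) with hξ
  set w := φ v with hw
  have hs : ∀ a b, G a b = G b a := H.induced.symm y hy
  -- All terms are of rank one except the multiple of `φ² = -id + η ⊗ ξ`, of trace `1 - dim E`. With
  -- `w = φv`, the first four traces add up to `4 G(φu, w)` and the `φ²` term gives `2 (dim E - 1)
  -- G(φu, w)`; half the sum is `(dim E + 1) G(φu, w)`. The two shape terms have equal traces.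
  have hR : ((φ ∘L curvature (inducedMetric h Φ) y u w : E →L[ℝ] E) : E →ₗ[ℝ] E) =
      (c / 4) • ((G w : E →ₗ[ℝ] ℝ).smulRight (φ u) - (G u : E →ₗ[ℝ] ℝ).smulRight (φ w)
        + (G (φ w) : E →ₗ[ℝ] ℝ).smulRight (φ (φ u)) - (G (φ u) : E →ₗ[ℝ] ℝ).smulRight (φ (φ w))
        - (2 * G (φ u) w) • (-LinearMap.id + (G ξ : E →ₗ[ℝ] ℝ).smulRight ξ))
      + (G (A w) : E →ₗ[ℝ] ℝ).smulRight (φ (A u)) - (G (A u) : E →ₗ[ℝ] ℝ).smulRight (φ (A w)) := by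
    ext x
    have hx : φ (φ x) = -x + G ξ x • ξ := by rw [hs]; exact H.phi_phi hy (hν y hy) x
    simp only [ContinuousLinearMap.coe_coe, ContinuousLinearMap.comp_apply,
      H.curvature_induced_eq hn hν hol hy, map_add, map_sub, map_smul, ← hG, ← hφ, ← hA, hx,
      LinearMap.add_apply, LinearMap.sub_apply, LinearMap.smul_apply, LinearMap.smulRight_apply,
      LinearMap.neg_apply, LinearMap.id_apply]
  have hskew : ∀ a b, G (φ a) b = -G a (φ b) := H.phi_skew hy
  have hξφ : ∀ a, G (φ a) ξ = 0 := H.metric_phi_xi hy (hν y hy)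
  have hξξ : G ξ ξ = 1 := H.metric_xi_xi hy (hν y hy)
  rw [starRic, ← hφ, ← hw, hR]
  simp only [map_add, map_sub, map_smul, map_neg, LinearMap.trace_smulRight,
    ContinuousLinearMap.coe_coe, LinearMap.trace_id, smul_eq_mul, hξξ]
  have e1 : G (φ w) (φ (φ u)) = G w (φ u) := by
    have : φ (φ u) = -u + G u ξ • ξ := H.phi_phi hy (hν y hy) u
    rw [this, map_add, map_smul, hξφ, map_neg, hskew, neg_neg, smul_zero, add_zero]
  have e2 : G (φ u) (φ (φ w)) = G u (φ w) := by
    have : φ (φ w) = -w + G w ξ • ξ := H.phi_phi hy (hν y hy) w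
    rw [this, map_add, map_smul, hξφ, map_neg, hskew, neg_neg, zero_smul, add_zero]
  have e3 : G (A u) (φ (A w)) = -G (A w) (φ (A u)) := by
    rw [← neg_neg (G (A u) _), ← hskew, hs]
  rw [e1, e2, e3, hs w, hs (φ (A u)), ← neg_neg (G u (φ w)), ← hskew]
  ring

end NormalField

end IsHypersurfaceOn

end SpaceForm

/-! ### The soliton equation and the vanishing of `V` -/

section Soliton

variable {E : Type*} [NormedAddCommGroup E] [NormedSpace ℝ E] [FiniteDimensional ℝ E]
  {F : Type*} [NormedAddCommGroup F] [NormedSpace ℂ F] [FiniteDimensional ℂ F]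
  {h : F → F →L[ℝ] F →L[ℝ] ℝ} {Φ : E → F} {s : Set E} {t : Set F} {c : ℝ}

/-- Metric compatibility expands `∂_W g`, and the symmetry of `Γ` absorbs the result into covariant
derivatives. The derivatives of `W` are the same on both sides, so no regularity of `W` is needed.
-/
theorem IsMetricOn.lieMetric_eq {g : E → E →L[ℝ] E →L[ℝ] ℝ} (hg : IsMetricOn g s) {y : E}
    (hy : y ∈ s) (W : E → E) (u v : E) :
    lieMetric W g y u v = g y (covAlong g (fun z => z) W y u) v
      + g y u (covAlong g (fun z => z) W y v) := by
  simp only [lieMetric, hg.fderiv_eq hy, covAlong, fderiv_fun_id, ContinuousLinearMap.id_apply,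
    map_add, add_apply]
  rw [hg.christoffel_comm hy (W y) u, hg.christoffel_comm hy (W y) v]
  ring

namespace IsHypersurfaceOn

variable (H : IsHypersurfaceOn h Φ s t)
include H

theorem metric_holPart_xi {y : E} (hy : y ∈ s) {ν : F} (hν : IsUnitNormal h Φ y ν) :
    inducedMetric h Φ y (holPart h Φ y ν) (xi h Φ y ν) = 0 := by
  simp [holPart, H.metric_xi_xi hy hν]

theorem shape_xi (y : E) (ν : F) :
    shape h Φ y ν (xi h Φ y ν) = holPart h Φ y ν +
      inducedMetric h Φ y (shape h Φ y ν (xi h Φ y ν)) (xi h Φ y ν) • xi h Φ y ν := by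
  simp [holPart]

theorem phi_shape_xi {y : E} (hy : y ∈ s) {ν : F} (hν : IsUnitNormal h Φ y ν) :
    phi h Φ y (shape h Φ y ν (xi h Φ y ν)) = phi h Φ y (holPart h Φ y ν) := by
  rw [H.shape_xi, map_add, map_smul, H.phi_xi hy hν, smul_zero, add_zero]

/-- Immediate from `φξ = 0` in the right slot. In the left slot `ξ` gives no such vanishing for
free; this asymmetry is what the symmetry forced by the soliton equation exploits. -/
theorem starRic_xi_right {y : E} (hy : y ∈ s) {ν : F} (hν : IsUnitNormal h Φ y ν) (u : E) :
    starRic h Φ y u (xi h Φ y ν) = 0 := by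
  have h0 : curvature (inducedMetric h Φ) y u 0 = 0 := by
    ext; simp [curvature]
  rw [starRic, H.phi_xi hy hν, h0, ContinuousLinearMap.comp_zero]
  simp

section NormalField

variable {n : E → F} (hn : ContDiffOn ℝ ∞ n s) (hν : ∀ z ∈ s, IsUnitNormal h Φ z (n z))
include hn hν

/-- The covariant derivative of the structure vector field is `∇_u ξ = φ A u`. -/
theorem covAlong_xi {y : E} (hy : y ∈ s) (u : E) :
    covAlong (inducedMetric h Φ) (fun z => z) (fun z => xi h Φ z (n z)) y u =
      phi h Φ y (shape h Φ y (n y) u) := by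
  have hnd : DifferentiableAt ℝ n y := (H.normal_contDiffAt hn hy).differentiableAt (by simp)
  have hξ : DifferentiableAt ℝ (fun z => xi h Φ z (n z)) y :=
    (H.xi_contDiffAt hy (H.normal_contDiffAt hn hy)).differentiableAt (by simp)
  have h1 : (fun z => fderiv ℝ Φ z (xi h Φ z (n z))) =ᶠ[nhds y] fun z => -cplxJ F (n z) := by
    filter_upwards [H.imm.isOpen.mem_nhds hy] with z hz using H.fderiv_xi hz (hν z hz)
  -- As `J` is parallel, `dΦ ξ = -Jn` has derivative `-J ∇̃_u n = J dΦ(Au)`, whose tangential part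
  -- is `φAu`.
  have h2 : covAlong h Φ (fun z => -cplxJ F (n z)) y u = -cplxJ F (covAlong h Φ n y u) := by
    have h3 : fderiv ℝ (fun z => -cplxJ F (n z)) y = -(cplxJ F ∘L fderiv ℝ n y) := by
      rw [fderiv_fun_neg]
      exact congrArg _ ((cplxJ F).hasFDerivAt.comp y hnd.hasFDerivAt).fderiv
    rw [covAlong, covAlong, h3, map_neg, H.parallel _ (H.imm.mapsTo hy), map_add, neg_add]
    rfl
  have h4 := covAlong_congr (h := h) (Φ := Φ) h1 u
  rw [h2, H.covAlong_fderiv hy hξ, H.covAlong_normal hn hν hy, map_neg, neg_neg,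
    H.J_fderiv hy (hν y hy), H.ambientDeriv_eq hy (hν y hy)] at h4
  have h5 := congrArg (tangPart h Φ y) h4
  simp only [map_add, map_smul, H.tangPart_fderiv hy, H.tangPart_normal hy (hν y hy), smul_zero,
    add_zero] at h5
  rw [← h5]
  simp [covAlong]

/-- A *-Ricci soliton whose potential field is the component of `Aξ` orthogonal to `ξ` has
constant `0`. -/
theorem soliton_const_eq_zero {W : E → E} (hW : ∀ z ∈ s, W z = holPart h Φ z (n z)) {lam : ℝ}
    (hsol : ∀ z ∈ s, ∀ u v, (1 / 2) * lieMetric W (inducedMetric h Φ) z u v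
      + starRic h Φ z u v - lam * inducedMetric h Φ z u v = 0) {y : E} (hy : y ∈ s) :
    lam = 0 := by
  have hνy := hν y hy
  have hWd : DifferentiableAt ℝ W y := by
    have h1 : W =ᶠ[nhds y] fun z => holPart h Φ z (n z) := by
      filter_upwards [H.imm.isOpen.mem_nhds hy] with z hz using hW z hz
    exact h1.differentiableAt_iff.2
      ((H.holPart_contDiffAt hy (H.normal_contDiffAt hn hy)).differentiableAt (by simp))
  have hξ : DifferentiableAt ℝ (fun z => xi h Φ z (n z)) y :=
    (H.xi_contDiffAt hy (H.normal_contDiffAt hn hy)).differentiableAt (by simp)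
  have h1 := fderiv_metric_along H.induced (isImmersionOn_id H.imm.isOpen) hy hWd hξ
    (xi h Φ y (n y))
  have h2 : (fun z => inducedMetric h Φ z (W z) (xi h Φ z (n z))) =ᶠ[nhds y] fun _ => 0 := by
    filter_upwards [H.imm.isOpen.mem_nhds hy] with z hz
    rw [hW z hz, H.metric_holPart_xi hz (hν z hz)]
  rw [h2.fderiv_eq, H.covAlong_xi hn hν hy, H.phi_shape_xi hy hνy, hW y hy,
    H.induced.symm y hy (holPart h Φ y (n y)), H.metric_phi_self hy, add_zero] at h1
  -- On `(ξ, ξ)` the Lie derivative term is `g(∇_ξ V, ξ) = -g(V, φV) = 0` and the *-Ricci term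
  -- vanishes, leaving the constant.
  have h3 := hsol y hy (xi h Φ y (n y)) (xi h Φ y (n y))
  rw [H.induced.lieMetric_eq hy, H.starRic_xi_right hy hνy, H.metric_xi_xi hy hνy,
    H.induced.symm y hy (xi h Φ y (n y)), ← h1] at h3
  simpa using h3

variable (hol : ∀ z ∈ t, ∀ u, h z (curvature h z u (cplxJ F u) (cplxJ F u)) u = c * h z u u ^ 2)
include hol

/-- Symmetry of the *-Ricci tensor forces `A φ V = 0`. -/
theorem shape_phi_holPart_eq_zero {y : E} (hy : y ∈ s)
    (hsymm : ∀ u v, starRic h Φ y u v = starRic h Φ y v u) :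
    shape h Φ y (n y) (phi h Φ y (holPart h Φ y (n y))) = 0 := by
  have hνy := hν y hy
  set V := holPart h Φ y (n y) with hV
  set z := shape h Φ y (n y) (phi h Φ y V) with hz
  -- `0 = Ric*(v, ξ) = Ric*(ξ, v) = g(φV, Aφv) = g(AφV, φv)`; the term with `c` contains `φξ = 0`.
  have h1 (v : E) : inducedMetric h Φ y z (phi h Φ y v) = 0 := by
    have h2 := H.starRic_eq hn hν hol hy (xi h Φ y (n y)) v
    rw [hsymm, H.starRic_xi_right hy hνy, H.phi_xi hy hνy, H.phi_shape_xi hy hνy,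
      ← H.shape_symm hy] at h2
    simpa using h2.symm
  have h3 : phi h Φ y z = 0 := H.induced.ext hy fun w => by
    rw [H.phi_skew hy, h1]; simp
  have h4 := H.phi_phi hy hνy z
  have h5 : inducedMetric h Φ y z (xi h Φ y (n y)) = 0 := by
    rw [hz, H.shape_symm hy, H.shape_xi, ← hV, map_add, map_smul, H.metric_phi_self hy,
      H.metric_phi_xi hy hνy]
    simp
  rw [h3, h5, map_zero, zero_smul, add_zero] at h4
  exact neg_eq_zero.1 h4.symm

/-- If `A φ V = 0` everywhere, then `g(∇_p V, p) = 0` for `p = φ V`, by the Codazzi equation. -/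
theorem metric_covAlong_holPart_phi
    (hA : ∀ z ∈ s, shape h Φ z (n z) (phi h Φ z (holPart h Φ z (n z))) = 0) {y : E} (hy : y ∈ s) :
    inducedMetric h Φ y (covAlong (inducedMetric h Φ) (fun z => z) (fun z => holPart h Φ z (n z)) y
      (phi h Φ y (holPart h Φ y (n y)))) (phi h Φ y (holPart h Φ y (n y))) = 0 := by
  have hνy := hν y hy
  have hnc := H.normal_contDiffAt hn hy
  -- From here on `p` is frozen as a constant coordinate field; the resulting terms in `Γ(p, p)`
  -- cancel at the end.
  set p := phi h Φ y (holPart h Φ y (n y)) with hp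
  set ξ := xi h Φ y (n y) with hξ
  have hAp : shape h Φ y (n y) p = 0 := hA y hy
  have hApr (u : E) : inducedMetric h Φ y (shape h Φ y (n y) u) p = 0 := by
    rw [H.shape_symm hy, hAp, map_zero]
  have hid := isImmersionOn_id H.imm.isOpen
  have hξd : DifferentiableAt ℝ (fun z => xi h Φ z (n z)) y :=
    (H.xi_contDiffAt hy hnc).differentiableAt (by simp)
  have hPd : DifferentiableAt ℝ (fun z => phi h Φ z (holPart h Φ z (n z))) y :=
    ((H.phi_contDiffAt hy).clm_apply (H.holPart_contDiffAt hy hnc)).differentiableAt (by simp)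
  have hVd : DifferentiableAt ℝ (fun z => holPart h Φ z (n z)) y :=
    (H.holPart_contDiffAt hy hnc).differentiableAt (by simp)
  have hGd := H.induced.differentiableAt hy
  let α : E → E →L[ℝ] E →L[ℝ] ℝ := fun z => inducedMetric h Φ z ∘L shape h Φ z (n z)
  have hα (z u v : E) : α z u v = inducedMetric h Φ z (shape h Φ z (n z) u) v := rfl
  have hαd : DifferentiableAt ℝ α y :=
    ((H.induced.contDiffAt hy).clm_comp (H.shape_contDiffAt hy hnc)).differentiableAt (by simp)
  have hfα (u v w : E) : fderiv ℝ (fun z => inducedMetric h Φ z (shape h Φ z (n z) v) w) y u =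
      fderiv ℝ α y u v w := by
    simpa [hα] using fderiv_bilin hαd (differentiableAt_const v) (differentiableAt_const w) u
  have hpξ : inducedMetric h Φ y p ξ = 0 := H.metric_phi_xi hy hνy _
  -- Normal part of the curvature for `(p, ξ, p)`. The ambient side vanishes because `Jp ⟂ p`, `Jξ`
  -- is normal and hence `Jp ⟂ ξ`; the term with `Γ(ξ, p)` vanishes because `Ap = 0`.
  have hcod : fderiv ℝ α y p ξ p - fderiv ℝ α y ξ p p
      - inducedMetric h Φ y (shape h Φ y (n y) ξ) (christoffel (inducedMetric h Φ) y p p) = 0 := by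
    have h1 := congrArg (fun z => h (Φ y) z (n y)) (H.gauss_codazzi hn hν hy p ξ p)
    have hs := H.metric.symm _ (H.imm.mapsTo hy)
    have hd (u : E) : h (Φ y) (fderiv ℝ Φ y u) (n y) = 0 := by rw [hs, hνy.1]
    simp only [H.ambient_curvature_eq hol hy, map_add (h (Φ y)), add_apply, map_smul (h (Φ y)),
      smul_apply, hd, hνy.2, H.metric_J_self hy, hfα, hAp, map_zero, zero_apply] at h1
    have hJξ : h (Φ y) (cplxJ F (fderiv ℝ Φ y ξ)) (fderiv ℝ Φ y p) = 0 := by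
      rw [hξ, H.fderiv_xi hy hνy, map_neg, cplxJ_cplxJ, neg_neg, hνy.1]
    have hJp : h (Φ y) (cplxJ F (fderiv ℝ Φ y p)) (fderiv ℝ Φ y ξ) = 0 := by
      rw [H.skew_J hy, hs, hJξ, neg_zero]
    rw [hJξ, hJp] at h1
    simp only [smul_eq_mul] at h1
    linarith
  -- Differentiate `α(φV, φV) = 0` with the moving field `φV`; the derivatives of `φV` are paired
  -- with `Ap = 0`.
  have hξα : fderiv ℝ α y ξ p p = 0 := by
    have h1 := fderiv_bilin hαd hPd hPd ξ
    have h2 : (fun z => α z (phi h Φ z (holPart h Φ z (n z))) (phi h Φ z (holPart h Φ z (n z))))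
        =ᶠ[nhds y] fun _ => 0 := by
      filter_upwards [H.imm.isOpen.mem_nhds hy] with z hz
      simp [hα, hA z hz]
    rw [h2.fderiv_eq] at h1
    simp only [← hp, hα, hAp, hApr, map_zero, zero_apply, add_zero, fderiv_fun_const,
      Pi.zero_apply] at h1
    exact h1.symm
  let a : E → ℝ := fun z => inducedMetric h Φ z (shape h Φ z (n z) (xi h Φ z (n z))) (xi h Φ z (n z))
  have had : DifferentiableAt ℝ a y := (hαd.clm_apply hξd).clm_apply hξd
  -- Differentiating `g(V, p) = α(ξ, p) - a g(ξ, p)` along `p` brings in `∂_p α(ξ, p)`, which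
  -- Codazzi equates to `g(Aξ, Γ(p, p))`. The terms with `∇_p ξ = φAp` and with the derivative of
  -- `a` vanish.
  have hVeq : (fun z => inducedMetric h Φ z (holPart h Φ z (n z)) p) =
      (fun z => α z (xi h Φ z (n z)) p) -
        fun z => a z * inducedMetric h Φ z (xi h Φ z (n z)) p := by
    funext z
    simp [holPart, hα, a]
  have h1 := fderiv_metric_along H.induced hid hy hVd (differentiableAt_const p) p
  have hd1 : DifferentiableAt ℝ (fun z => α z (xi h Φ z (n z)) p) y :=
    (hαd.clm_apply hξd).clm_apply (differentiableAt_const p)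
  have hd2 : DifferentiableAt ℝ (fun z => inducedMetric h Φ z (xi h Φ z (n z)) p) y :=
    (hGd.clm_apply hξd).clm_apply (differentiableAt_const p)
  have h2 := fderiv_bilin hαd hξd (differentiableAt_const p) p
  have h3 := fderiv_metric_along H.induced hid hy hξd (differentiableAt_const p) p
  rw [hVeq, fderiv_sub hd1 (had.fun_mul hd2), fderiv_fun_mul had hd2] at h1
  simp only [sub_apply, add_apply, smul_apply] at h1
  have hcp : covAlong (inducedMetric h Φ) (fun z => z) (fun _ => p) y p =
      christoffel (inducedMetric h Φ) y p p := by simp [covAlong]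
  rw [h2, h3, H.covAlong_xi hn hν hy, hAp, hcp, ← hξ, H.induced.symm y hy ξ p, hpξ] at h1
  have hξV := congrArg (fun u => inducedMetric h Φ y u (christoffel (inducedMetric h Φ) y p p))
    (H.shape_xi y (n y))
  simp only [map_add, map_smul, add_apply, smul_apply, smul_eq_mul, ← hξ] at hξV
  simp only [hα, hApr, map_zero, zero_apply, fderiv_fun_const, Pi.zero_apply,
    smul_eq_mul] at h1
  have ha : a y = inducedMetric h Φ y (shape h Φ y (n y) ξ) ξ := rfl
  rw [ha] at h1
  linarith

end NormalField

/-- The potential field of a *-Ricci soliton on a real hypersurface of a complex space form vanishes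
if it is the component of `Aξ` orthogonal to `ξ`. -/
theorem soliton_rigidity (hc : c ≠ 0)
    (hol : ∀ z ∈ t, ∀ u, h z (curvature h z u (cplxJ F u) (cplxJ F u)) u = c * h z u u ^ 2)
    {W : E → E} (hW : ∀ z ∈ s, ∀ ν, IsUnitNormal h Φ z ν → W z = holPart h Φ z ν) {lam : ℝ}
    (hsol : ∀ z ∈ s, ∀ u v, (1 / 2) * lieMetric W (inducedMetric h Φ) z u v
      + starRic h Φ z u v - lam * inducedMetric h Φ z u v = 0) {y : E} (hy : y ∈ s) :
    W y = 0 ∧ lam = 0 := by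
  obtain ⟨ν, hν⟩ := H.exists_unitNormal hy
  obtain ⟨s', hs', hy', H', n, -, hn, hn'⟩ := H.exists_normal_field hy hν
  have hWn (z) (hz : z ∈ s') : W z = holPart h Φ z (n z) := hW z (hs' hz) _ (hn' z hz)
  have hsol' (z) (hz : z ∈ s') := hsol z (hs' hz)
  have hlam : lam = 0 := H'.soliton_const_eq_zero hn hn' hWn hsol' hy'
  refine ⟨?_, hlam⟩
  -- `Ric*` equals a multiple of `g` minus half a Lie derivative of `g`, both symmetric.
  have hsymm (z) (hz : z ∈ s') (u v : E) : starRic h Φ z u v = starRic h Φ z v u := by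
    have h1 := hsol' z hz u v
    have h2 := hsol' z hz v u
    rw [H'.induced.lieMetric_eq hz] at h1 h2
    have h3 := H'.induced.symm z hz
    rw [h3 v u, h3 _ u, h3 v] at h2
    linarith
  have hA (z) (hz : z ∈ s') := H'.shape_phi_holPart_eq_zero hn hn' hol hz (hsymm z hz)
  have h1 := H'.metric_covAlong_holPart_phi hn hn' hol hA hy'
  set p := phi h Φ y (holPart h Φ y (n y)) with hp
  have hWev : W =ᶠ[nhds y] fun z => holPart h Φ z (n z) := by
    filter_upwards [H'.imm.isOpen.mem_nhds hy'] with z hz using hWn z hz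
  rw [← covAlong_congr hWev] at h1
  have h2 := hsol' y hy' p p
  have hphi : phi h Φ y p = -holPart h Φ y (n y) := by
    rw [hp, H'.phi_phi hy' (hn' y hy'), H'.metric_holPart_xi hy' (hn' y hy')]
    simp
  rw [H'.induced.lieMetric_eq hy', H'.induced.symm y hy' p, h1, hlam,
    H'.starRic_eq hn hn' hol hy', hA y hy', hphi] at h2
  -- With `φp = -V` and `Ap = 0`, the equation on `(p, p)` is now `c (dim E + 1) / 4 · g(V, V) = 0`.
  simp only [map_zero, map_neg, neg_apply, neg_neg, zero_apply, zero_mul, add_zero, sub_zero,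
    mul_zero, zero_add, neg_zero, ← hWn y hy', mul_eq_zero, div_eq_zero_iff, hc, false_or] at h2
  by_contra hne
  have hpos := H'.induced.pos y hy' _ hne
  rcases h2 with (h2 | h2) | h2
  · have : (0 : ℝ) < finrank ℝ E + 1 := by positivity
    exact this.ne' h2
  · norm_num at h2
  · exact hpos.ne' h2

end IsHypersurfaceOn

end Soliton

/-! ### From the manifolds to coordinate charts -/

section Charts

variable {F : Type*} [NormedAddCommGroup F] [NormedSpace ℂ F] [FiniteDimensional ℂ F]
  {N : Type*} [TopologicalSpace N] [ChartedSpace F N] [IsManifold 𝓘(ℂ, F) ω N]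
  {E : Type*} [NormedAddCommGroup E] [NormedSpace ℝ E] [FiniteDimensional ℝ E]
  {M : Type*} [TopologicalSpace M] [ChartedSpace E M] [IsManifold 𝓘(ℝ, E) ∞ M]

theorem coordFrame_injective {e : OpenPartialHomeomorph N F} (he : e ∈ atlas F N) {z : F}
    (hz : z ∈ e.target) : Function.Injective (coordFrame e z) :=
  (mdifferentiable_of_mem_atlas (I := 𝓘(ℝ, F)) he).symm.mfderiv_injective hz

/-- This is the tangent map of `e.symm` applied to a constant field; on the open target the
derivative within the set is the full derivative. -/
theorem contMDiffOn_coordFrame {e : OpenPartialHomeomorph N F} (he : e ∈ atlas F N) (u : F) :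
    ContMDiffOn 𝓘(ℝ, F) 𝓘(ℝ, F).tangent ∞
      (fun z => (⟨e.symm z, coordFrame e z u⟩ : TangentBundle 𝓘(ℝ, F) N)) e.target := by
  have h1 : ContMDiffOn 𝓘(ℝ, F) 𝓘(ℝ, F) ω e.symm e.target :=
    contMDiffOn_symm_of_mem_maximalAtlas (IsManifold.subset_maximalAtlas he)
  have h2 := h1.contMDiffOn_tangentMapWithin (m := ∞) (by simp) e.open_target.uniqueMDiffOn
  have h3 : ContMDiffOn 𝓘(ℝ, F) 𝓘(ℝ, F).tangent ∞
      (fun z => (⟨z, u⟩ : TangentBundle 𝓘(ℝ, F) F)) e.target :=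
    contMDiffOn_vectorSpace_iff_contDiffOn.2 contDiffOn_const
  refine (h2.comp h3 fun z hz => hz).congr fun z hz => ?_
  have h4 : MDifferentiableAt 𝓘(ℝ, F) 𝓘(ℝ, F) e.symm z :=
    (mdifferentiable_of_mem_atlas (I := 𝓘(ℝ, F)) he).mdifferentiableAt_symm hz
  exact (tangentMapWithin_eq_tangentMap (p := (⟨z, u⟩ : TangentBundle 𝓘(ℝ, F) F))
    (e.open_target.uniqueMDiffWithinAt hz) h4).symm

theorem chartMetric_apply_contDiffOn (g : Metric F N) {e : OpenPartialHomeomorph N F}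
    (he : e ∈ atlas F N) (u v : F) : ContDiffOn ℝ ∞ (fun z => chartMetric g e z u v) e.target := by
  rw [← contMDiffOn_iff_contDiffOn]
  intro z hz
  have hb : ContMDiffWithinAt 𝓘(ℝ, F) 𝓘(ℝ, F) ∞ e.symm e.target z :=
    contMDiffOn_symm_of_mem_maximalAtlas (IsManifold.subset_maximalAtlas he) z hz
  -- The values are viewed as a section of the trivial line bundle, so that the smooth bundle metric
  -- can be evaluated on two smooth sections.
  have h1 : ContMDiffWithinAt 𝓘(ℝ, F) (𝓘(ℝ, F).prod 𝓘(ℝ)) ∞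
      (fun z => Bundle.TotalSpace.mk' ℝ (E := Bundle.Trivial N ℝ) (e.symm z)
        (g.inner (e.symm z) (coordFrame e z u) (coordFrame e z v))) e.target z := by
    apply ContMDiffWithinAt.clm_bundle_apply₂ (F₁ := F) (F₂ := F)
    · exact ContMDiffAt.comp_contMDiffWithinAt z g.contMDiff.contMDiffAt hb
    · exact contMDiffOn_coordFrame he u z hz
    · exact contMDiffOn_coordFrame he v z hz
  simp only [Bundle.contMDiffWithinAt_totalSpace] at h1
  exact h1.2

theorem chartMetric_symm (g : Metric F N) (e : OpenPartialHomeomorph N F) (z u v : F) :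
    chartMetric g e z u v = chartMetric g e z v u :=
  g.symm (e.symm z) (coordFrame e z u) (coordFrame e z v)

theorem chartMetric_pos (g : Metric F N) {e : OpenPartialHomeomorph N F} (he : e ∈ atlas F N)
    {z : F} (hz : z ∈ e.target) {u : F} (hu : u ≠ 0) : 0 < chartMetric g e z u u :=
  g.pos (e.symm z) (coordFrame e z u)
    fun h0 => hu (coordFrame_injective he hz (h0.trans (map_zero (coordFrame e z)).symm))

theorem isMetricOn_chartMetric (g : Metric F N) {e : OpenPartialHomeomorph N F}
    (he : e ∈ atlas F N) : IsMetricOn (chartMetric g e) e.target where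
  isOpen := e.open_target
  smooth := contDiffOn_clm_apply.2 fun u => contDiffOn_clm_apply.2 fun v =>
    chartMetric_apply_contDiffOn g he u v
  symm z _ u v := chartMetric_symm g e z u v
  pos _ hz _ hu := chartMetric_pos g he hz hu

theorem isImmersionOn_chartMap {f : M → N} (hf : IsSmoothImmersion E F f)
    {e : OpenPartialHomeomorph M E} (he : e ∈ atlas E M) {e' : OpenPartialHomeomorph N F}
    (he' : e' ∈ atlas F N) : IsImmersionOn (chartMap f e e') (chartDomain f e e') e'.target where
  isOpen := by
    have h1 : chartDomain f e e' = e.target ∩ e.symm ⁻¹' (f ⁻¹' e'.source) := rfl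
    rw [h1]
    exact e.symm.isOpen_inter_preimage (e'.open_source.preimage hf.1.continuous)
  smooth := by
    rw [← contMDiffOn_iff_contDiffOn]
    have h1 : ContMDiffOn 𝓘(ℝ, E) 𝓘(ℝ, E) ∞ e.symm e.target :=
      contMDiffOn_symm_of_mem_maximalAtlas (IsManifold.subset_maximalAtlas he)
    have h2 : ContMDiffOn 𝓘(ℝ, F) 𝓘(ℝ, F) ∞ e' e'.source :=
      contMDiffOn_of_mem_maximalAtlas (IsManifold.subset_maximalAtlas he')
    exact h2.comp (hf.1.comp_contMDiffOn (h1.mono fun y hy => hy.1)) fun y hy => hy.2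
  mapsTo y hy := e'.map_source hy.2
  inj y hy := by
    have d1 := mdifferentiable_of_mem_atlas (I := 𝓘(ℝ, E)) he
    have d2 := mdifferentiable_of_mem_atlas (I := 𝓘(ℝ, F)) he'
    have h1 := d1.symm.mfderiv_injective (x := y) hy.1
    have h2 := d2.mfderiv_injective (x := f (e.symm y)) hy.2
    have hfd : MDifferentiableAt 𝓘(ℝ, E) 𝓘(ℝ, F) f (e.symm y) :=
      hf.1.mdifferentiableAt (by simp)
    have h3 : mfderiv 𝓘(ℝ, E) 𝓘(ℝ, F) (chartMap f e e') y =
        (mfderiv 𝓘(ℝ, F) 𝓘(ℝ, F) e' (f (e.symm y))).comp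
          ((mfderiv 𝓘(ℝ, E) 𝓘(ℝ, F) f (e.symm y)).comp (mfderiv 𝓘(ℝ, E) 𝓘(ℝ, E) e.symm y)) := by
      have h4 := mfderiv_comp y hfd (d1.mdifferentiableAt_symm hy.1)
      rw [← h4]
      exact mfderiv_comp (g := e') (f := f ∘ e.symm) y (d2.mdifferentiableAt hy.2)
        (hfd.comp y (d1.mdifferentiableAt_symm hy.1))
    rw [← mfderiv_eq_fderiv, h3]
    exact h2.comp ((hf.2 _).comp h1)

theorem isHypersurfaceOn_chartMap {g : Metric F N} (hg : IsKaehler g)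
    (hcodim : finrank ℝ F = finrank ℝ E + 1) {f : M → N} (hf : IsSmoothImmersion E F f)
    {e : OpenPartialHomeomorph M E} (he : e ∈ atlas E M) {e' : OpenPartialHomeomorph N F}
    (he' : e' ∈ atlas F N) :
    IsHypersurfaceOn (chartMetric g e') (chartMap f e e') (chartDomain f e e') e'.target where
  metric := isMetricOn_chartMetric g he'
  imm := isImmersionOn_chartMap hf he he'
  herm z hz u v := (hg e' he' z hz u v).1
  parallel z hz u v := (hg e' he' z hz u v).2
  codim := hcodim

end Charts

end StarRicci

/-! ### The global statement -/

theorem proposition6p2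
    (n : ℕ) (hn : 2 ≤ n)
    {F : Type*} [NormedAddCommGroup F] [NormedSpace ℂ F] [FiniteDimensional ℂ F]
    (hF : finrank ℂ F = n)
    {N : Type*} [TopologicalSpace N] [ChartedSpace F N] [IsManifold 𝓘(ℂ, F) ω N]
    (g : StarRicci.Metric F N) (c : ℝ) (hc : c ≠ 0) (hg : StarRicci.IsComplexSpaceForm g c)
    {E : Type*} [NormedAddCommGroup E] [NormedSpace ℝ E] [FiniteDimensional ℝ E]
    (hE : finrank ℝ E = 2 * n - 1)
    {M : Type*} [TopologicalSpace M] [ChartedSpace E M] [IsManifold 𝓘(ℝ, E) ∞ M] [Nonempty M]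
    (f : M → N) (hf : StarRicci.IsSmoothImmersion E F f)
    (V : ∀ p : M, TangentSpace 𝓘(ℝ, E) p) (hV : StarRicci.IsHolPart g f V)
    (lam : ℝ) (hsol : StarRicci.IsStarRicciSoliton g f V lam) :
    StarRicci.IsHopf E g f ∧ StarRicci.IsStarRicciFlat E g f ∧ (∀ p : M, V p = 0) ∧ lam = 0 := by
  -- The truncated subtraction `2 * n - 1` is a true one since `n ≥ 2`.
  have hcodim : finrank ℝ F = finrank ℝ E + 1 := by
    rw [finrank_real_of_complex, hF, hE]
    omega
  have main (e) (he : e ∈ atlas E M) (e') (he' : e' ∈ atlas F N) (y)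
      (hy : y ∈ StarRicci.chartDomain f e e') : StarRicci.chartField V e y = 0 ∧ lam = 0 :=
    (StarRicci.isHypersurfaceOn_chartMap hg.1 hcodim hf he he').soliton_rigidity hc
      (hg.2 e' he') (hV e he e' he') (hsol.2 e he e' he') hy
  have mem (p : M) : chartAt E p p ∈
      StarRicci.chartDomain f (chartAt E p) (chartAt F (f p)) :=
    ⟨mem_chart_target E p, by
      rw [(chartAt E p).left_inv (mem_chart_source E p)]
      exact mem_chart_source F (f p)⟩
  have hV0 (p : M) : V p = 0 := by
    have h1 := (main _ (chart_mem_atlas E p) _ (chart_mem_atlas F (f p)) _ (mem p)).1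
    rw [StarRicci.chartField, (chartAt E p).left_inv (mem_chart_source E p)] at h1
    exact (mdifferentiable_of_mem_atlas (I := 𝓘(ℝ, E)) (chart_mem_atlas E p)).mfderiv_injective
      (mem_chart_source E p) (h1.trans (map_zero _).symm)
  have hlam : lam = 0 := by
    obtain ⟨p⟩ := ‹Nonempty M›
    exact (main _ (chart_mem_atlas E p) _ (chart_mem_atlas F (f p)) _ (mem p)).2
  refine ⟨fun e he e' he' y hy ν hν => ?_, fun e he e' he' y hy u v => ?_, hV0, hlam⟩
  · have h1 := hV e he e' he' y hy ν hν
    rw [(main e he e' he' y hy).1, StarRicci.holPart] at h1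
    exact ⟨_, sub_eq_zero.1 h1.symm⟩
  · have h1 := hsol.2 e he e' he' y hy u v
    -- Equality as functions on all of `E`, so that the derivative of the field in the Lie
    -- derivative vanishes too.
    have h2 : StarRicci.chartField V e = fun _ => 0 := by
      funext z
      rw [StarRicci.chartField, hV0, map_zero]
      rfl
    rw [h2, hlam] at h1
    simpa [StarRicci.lieMetric] using h1
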